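/- Let $G$ be a finite simple graph with exactly one cycle. For a field $K$, let $R=K[V(G)]$ be the polynomial ring whose indeterminates are the vertices of $G$, and let $I(G)\subset R$ be the edge ideal of $G$, i.e. the ideal generated by the products $xy$ with $\{x,y\}$ an edge of $G$. Suppose that $G$ is Cohen–Macaulay, i.e. that $R/I(G)$ is a Cohen–Macaulay ring for every field $K$. Then, for every field $K$, the ideal $I(G)$ is a set-theoretic complete intersection, i.e. $\operatorname{ara} I(G)=\operatorname{ht} I(G)$, where $\operatorname{ara} I(G)$ is the least number of elements of $R$ that generate an ideal whose radical is $I(G)$, and $\operatorname{ht}$ denotes the height. -/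

import Mathlib

universe u v w

/-- A local ring is Cohen–Macaulay if it is Noetherian and its depth equals its Krull dimension,
i.e. the maximal ideal contains a regular sequence whose length is the Krull dimension. (In a
Noetherian local ring no regular sequence in the maximal ideal is longer than that.) -/
def IsCohenMacaulayLocal (A : Type*) [CommRing A] [IsLocalRing A] : Prop :=
  IsNoetherianRing A ∧
    ∃ rs : List A, (∀ r ∈ rs, r ∈ IsLocalRing.maximalIdeal A) ∧
      RingTheory.Sequence.IsRegular A rs ∧ ((rs.length : ℕ) : WithBot ℕ∞) = ringKrullDim A

/-- A ring is Cohen–Macaulay if it is Noetherian and its localizations at all maximal ideals are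
Cohen–Macaulay local rings. -/
def IsCohenMacaulay (A : Type*) [CommRing A] : Prop :=
  IsNoetherianRing A ∧
    ∀ (m : Ideal A) [m.IsMaximal], IsCohenMacaulayLocal (Localization.AtPrime m)

/-- The arithmetical rank of an ideal `I`: the least number of elements that generate `I` up to
radical (and `⊤` if no finite set does). -/
noncomputable def arithmeticalRank {R : Type*} [CommRing R] (I : Ideal R) : ℕ∞ :=
  ⨅ (s : Finset R) (_ : (Ideal.span (s : Set R)).radical = I.radical), (s.card : ℕ∞)

/-- `I` is a set-theoretic complete intersection if it can be generated up to radical by as many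
elements as its height, but not fewer: `ara I = ht I`. -/
def IsSetTheoreticCompleteIntersection {R : Type*} [CommRing R] (I : Ideal R) : Prop :=
  arithmeticalRank I = I.height

namespace SimpleGraph

/-- The edge ideal of `G` over `K`, in the polynomial ring whose indeterminates are the vertices:
it is generated by the products `x * y` of adjacent vertices. -/
noncomputable def edgeIdeal {V : Type u} (G : SimpleGraph V) (K : Type v) [Field K] :
    Ideal (MvPolynomial V K) :=
  Ideal.span {f | ∃ x y : V, G.Adj x y ∧ f = MvPolynomial.X x * MvPolynomial.X y}

/-- `G` is a Cohen–Macaulay graph if the quotient of the polynomial ring by its edge ideal is a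
Cohen–Macaulay ring over every field. -/
def IsCohenMacaulayGraph {V : Type u} (G : SimpleGraph V) : Prop :=
  ∀ (K : Type w) [Field K], IsCohenMacaulay (MvPolynomial V K ⧸ G.edgeIdeal K)

/-- `G` contains exactly one cycle: exactly one subgraph of `G` is traced out by a cyclic walk
(closed walks that differ in the starting point or the orientation give the same subgraph). -/
def HasExactlyOneCycle {V : Type u} (G : SimpleGraph V) : Prop :=
  ∃! H : G.Subgraph, ∃ (x : V) (c : G.Walk x x), c.IsCycle ∧ c.toSubgraph = H

end SimpleGraph

/-!
The arithmetical rank of `I(G)` is at least its height by Krull's height theorem, and the height is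
at least `m = |V| - k`, where `k` is the independence number (`WellCoveredOn.card_le_height`). So
`m` polynomials have to be found that generate `I(G)` up to radical.

The Cohen–Macaulay hypothesis is used, over a field of characteristic zero, only through two
consequences. All maximal independent sets have the same size (`exists_wellCoveredOn_univ`), because
the components of a Cohen–Macaulay variety through the origin have the same dimension. And the link
of an independent set `F`, that is, the subgraph induced outside the closed neighbourhood of `F`, is
never a cycle of length four or seven (`IsLink.not_isCycleOn_four`, `IsLink.not_isCycleOn_seven`):
the local ring at the indicator function of `F` would have a system of parameters that is not a
regular sequence, because of an explicit relation.

The polynomials are constructed by induction along links `W`. Isolated vertices and pendant edges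
are split off, with the link of a further vertex as remainder, until the set is edgeless or all
degrees are at least two. In the latter case `W` is the unique cycle of `G`
(`HasExactlyOneCycle.exists_isCycleOn`). A cycle of length six or at least eight is not
well-covered, and four and seven are excluded, so its length is three or five.

To split off a pendant edge `{a, b}` with `b` of degree one, one has to generate the edge ideal of
`W \ {a, b}`, together with `a` times the variables in `N(a)`. The sequence `f N` for
`N = N(a) \ {b}`, followed by `b`, cuts out the right set where `a ≠ 0`, while `f ∅` does where
`a = 0`. The Schmitt–Vogel principle (`mem_radical_span_add`) merges the two sequences into one,
with terms `a * f N j + f ∅ (j - 1)` and at the end `a * b + f ∅ (j - 1)`, provided that each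
`f ∅ j` vanishes wherever `f N 0, …, f N j` do. The induction therefore provides sequences `f N`
that generate the edges in `W` and the vertices in `N` up to radical, for all sets `N` whose
deletion does not change the independence number and preserves well-coveredness, and that are
compatible in this sense (`IsGeneratingFamily`). Only vertices with a neighbour outside `W` need
to be deleted. For a pentagon this matters: no two adjacent vertices of it have neighbours outside
(`HasExactlyOneCycle.not_exists_adj_of_five`), since otherwise some link would be a path with three
vertices, which is not well-covered.
-/

open MvPolynomial

/-! ### Regular sequences in Noetherian local rings -/

section LocalRing

open scoped Pointwise

open RingTheory.Sequence IsLocalRing CategoryTheory Abelian Limits in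
/-- Dividing by an arbitrary regular element `g` of the maximal ideal shortens the available regular
sequences by at most one, as the vanishing range of `Ext (S ⧸ maximalIdeal S) _` shows. -/
theorem exists_isRegular_quotSMulTop {S : Type u} [CommRing S] [IsLocalRing S]
    [IsNoetherianRing S] {M : Type u} [AddCommGroup M] [Module S M] [Module.Finite S M]
    [Nontrivial M] {n : ℕ} {g : S} (hg : g ∈ maximalIdeal S) (hreg : IsSMulRegular M g)
    (h : ∃ rs : List S, (∀ r ∈ rs, r ∈ maximalIdeal S) ∧ IsRegular M rs ∧ rs.length = n + 1) :
    ∃ rs : List S, (∀ r ∈ rs, r ∈ maximalIdeal S) ∧ IsRegular (QuotSMulTop g M) rs ∧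
      rs.length = n := by
  obtain ⟨rs, hmem, hrs, hlen⟩ := h
  have lt_top : ∀ (N : Type u) [AddCommGroup N] [Module S N] [Module.Finite S N] [Nontrivial N],
      maximalIdeal S • (⊤ : Submodule S N) < ⊤ := fun N _ _ _ _ =>
    (Submodule.top_ne_ideal_smul_of_le_jacobson_annihilator
      (maximalIdeal_le_jacobson _)).symm.lt_top
  have := nontrivial_quotSMulTop_of_mem_maximalIdeal M hg
  let k : ModuleCat.{u} S := ModuleCat.of S (S ⧸ maximalIdeal S)
  have suppk : Module.support S k = PrimeSpectrum.zeroLocus (maximalIdeal S) := by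
    rw [Module.support_eq_zeroLocus]
    change PrimeSpectrum.zeroLocus (Module.annihilator S (S ⧸ maximalIdeal S) : Set S) = _
    rw [Ideal.annihilator_quotient]
  have hfin : Module.Finite S k := inferInstanceAs (Module.Finite S (S ⧸ maximalIdeal S))
  have hext := ModuleCat.subsingleton_ext_of_exists_isRegular (maximalIdeal S) k suppk.subset
    (ModuleCat.of S M) (lt_top M) rs hmem hrs
  have hext' : ∀ i < n, Subsingleton (Ext k (ModuleCat.of S (QuotSMulTop g M)) i) := by
    intro i hi
    have zero1 := AddCommGrpCat.isZero_of_iff_subsingleton.mpr (hext i (by omega))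
    have zero2 := AddCommGrpCat.isZero_of_iff_subsingleton.mpr (hext (i + 1) (by omega))
    have hreg' : IsSMulRegular (ModuleCat.of S M) g := hreg
    exact AddCommGrpCat.subsingleton_of_isZero <| ShortComplex.Exact.isZero_of_both_zeros
      ((Ext.covariant_sequence_exact₃' k hreg'.smulShortComplex_shortExact) i (i + 1) rfl)
      (zero1.eq_zero_of_src _) (zero2.eq_zero_of_tgt _)
  obtain ⟨rs', h1, h2, h3⟩ := ModuleCat.exists_isRegular_of_exists_subsingleton_ext
    (maximalIdeal S) n (ModuleCat.of S (QuotSMulTop g M)) (lt_top _) k suppk hext'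
  exact ⟨rs', h2, h3, h1⟩

open RingTheory.Sequence IsLocalRing in
/-- The length of a regular sequence on `M` is at most the dimension of `S ⧸ p` for every associated
prime `p` of `M`. Inductively, if `x` is the first element, then `p + (x)` lies in an associated
prime `q` of `M / x M`, so `S ⧸ q` is a quotient of `(S ⧸ p) / x (S ⧸ p)`. -/
theorem length_le_supportDim_of_mem_associatedPrimes {S : Type u} [CommRing S] [IsLocalRing S]
    [IsNoetherianRing S] {rs : List S} :
    ∀ {M : Type u} [AddCommGroup M] [Module S M] [Module.Finite S M]
      (_ : ∀ r ∈ rs, r ∈ maximalIdeal S) (_ : IsRegular M rs) {p : Ideal S}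
      (_ : p ∈ associatedPrimes S M), (rs.length : WithBot ℕ∞) ≤ Module.supportDim S (S ⧸ p) := by
  induction rs with
  | nil =>
    intro M _ _ _ _ _ p hp
    have := hp.isPrime
    have : Nontrivial (S ⧸ p) := Ideal.Quotient.nontrivial_iff.2 hp.isPrime.ne_top
    rw [List.length_nil, Nat.cast_zero, Module.supportDim, Order.krullDim_nonneg_iff]
    exact (Module.nonempty_support_of_nontrivial (R := S) (M := S ⧸ p)).to_subtype
  | cons x xs ih =>
    intro M _ _ _ hmem hreg p hp
    have hprime := hp.isPrime
    rw [isRegular_cons_iff] at hreg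
    have hx : x ∈ maximalIdeal S := hmem x (by simp)
    have hxp : x ∉ p := by
      intro hxp
      have : x ∈ ⋃ p ∈ associatedPrimes S M, (p : Set S) := Set.mem_biUnion hp hxp
      rw [biUnion_associatedPrimes_eq_compl_regular] at this
      exact this hreg.1
    -- the submodule of elements killed by `p` is nonzero and, by Nakayama, not inside `x • M`
    obtain ⟨-, y, hy⟩ := isAssociatedPrime_iff.1 hp
    let N : Submodule S M :=
      { carrier := {m | ∀ a ∈ p, a • m = 0}
        add_mem' := fun {m n} hm hn a ha => by rw [smul_add, hm a ha, hn a ha, add_zero]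
        zero_mem' := fun a _ => smul_zero a
        smul_mem' := fun c m hm a ha => by rw [smul_comm, hm a ha, smul_zero] }
    have hyN : y ∈ N := fun a ha => by
      rw [hy, Submodule.mem_colon_singleton] at ha
      simpa using ha
    have hy0 : y ≠ 0 := by
      rintro rfl
      apply hprime.ne_top
      rw [hy]; ext; simp
    have hN : ∃ m ∈ N, m ∉ (x • (⊤ : Submodule S M) : Submodule S M) := by
      by_contra! hcon
      have hle : N ≤ maximalIdeal S • N := by
        intro m hm
        obtain ⟨m', -, rfl⟩ := (Submodule.mem_smul_pointwise_iff_exists _ _ _).1 (hcon m hm)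
        refine Submodule.smul_mem_smul hx fun a ha => hreg.1 ?_
        change x • a • m' = x • 0
        rw [smul_comm, hm a ha, smul_zero]
      have hbot := Submodule.eq_bot_of_le_smul_of_le_jacobson_bot (maximalIdeal S) N
        (IsNoetherian.noetherian N) hle (maximalIdeal_le_jacobson _)
      exact hy0 (by simpa [hbot] using hyN)
    obtain ⟨m, hmN, hm⟩ := hN
    obtain ⟨q, hq, hle⟩ := exists_le_isAssociatedPrime_of_isNoetherianRing S
      (Submodule.Quotient.mk (p := (x • (⊤ : Submodule S M) : Submodule S M)) m)
      (fun h => hm ((Submodule.Quotient.mk_eq_zero _).1 h))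
    have hpq : p ≤ q := fun a ha => hle (by
      rw [Submodule.mem_colon_singleton, ← Submodule.Quotient.mk_smul, hmN a ha]; simp)
    have hxq : x ∈ q := hle (by
      rw [Submodule.mem_colon_singleton, ← Submodule.Quotient.mk_smul, Submodule.mem_bot,
        Submodule.Quotient.mk_eq_zero]
      exact Submodule.smul_mem_pointwise_smul _ _ _ trivial)
    have h1 := ih (fun r hr => hmem r (by simp [hr])) hreg.2 hq
    have hxreg : IsSMulRegular (S ⧸ p) x := by
      rw [isSMulRegular_quotient_iff_mem_of_smul_mem]
      intro a ha
      exact (hprime.mem_or_mem ha).resolve_left hxp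
    rw [← Module.supportDim_quotSMulTop_succ_eq_supportDim hxreg hx, List.length_cons]
    push_cast
    gcongr
    refine h1.trans ?_
    let f : (S ⧸ p) →ₗ[S] (S ⧸ q) := Submodule.mapQ p q LinearMap.id hpq
    let f' : QuotSMulTop x (S ⧸ p) →ₗ[S] (S ⧸ q) := Submodule.liftQ _ f (by
      rintro _ h
      obtain ⟨b, -, rfl⟩ := (Submodule.mem_smul_pointwise_iff_exists _ _ _).1 h
      obtain ⟨c, rfl⟩ := Submodule.Quotient.mk_surjective _ b
      rw [LinearMap.mem_ker, map_smul]
      simp only [f, Submodule.mapQ_apply, LinearMap.id_apply]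
      rw [← Submodule.Quotient.mk_smul, Submodule.Quotient.mk_eq_zero]
      exact q.mul_mem_right c hxq)
    apply Module.supportDim_le_of_surjective f'
    intro b
    obtain ⟨c, rfl⟩ := Submodule.Quotient.mk_surjective _ b
    exact ⟨Submodule.Quotient.mk (Submodule.Quotient.mk c), rfl⟩

open IsLocalRing in
/-- If the elements of `gs` cut the support of `M` down to the closed point, then the dimension of
`M` is at most the length of `gs`. -/
theorem supportDim_le_length {S : Type u} [CommRing S] [IsLocalRing S] [IsNoetherianRing S]
    {gs : List S} : ∀ {M : Type u} [AddCommGroup M] [Module S M] [Module.Finite S M]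
      (_ : ∀ g ∈ gs, g ∈ maximalIdeal S)
      (_ : ∀ q ∈ Module.support S M, (∀ g ∈ gs, g ∈ q.asIdeal) → q.asIdeal = maximalIdeal S),
      Module.supportDim S M ≤ gs.length := by
  induction gs with
  | nil =>
    intro M _ _ _ _ h
    have : Subsingleton (Module.support S M) := ⟨fun a b => Subtype.ext <| PrimeSpectrum.ext <| by
      rw [h a.1 a.2 (by simp), h b.1 b.2 (by simp)]⟩
    simpa [Module.supportDim] using
      Order.krullDim_nonpos_of_subsingleton (α := Module.support S M)
  | cons g gs ih =>
    intro M _ _ _ hmem h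
    refine (Module.supportDim_le_supportDim_quotSMulTop_succ (hmem g (by simp))).trans ?_
    rw [List.length_cons]
    push_cast
    gcongr
    refine ih (fun r hr => hmem r (by simp [hr])) fun q hq hgs => ?_
    rw [Module.support_quotSMulTop] at hq
    refine h q hq.1 ?_
    simpa using ⟨by simpa using hq.2, hgs⟩

open RingTheory.Sequence IsLocalRing in
/-- In a Cohen–Macaulay module every system of parameters is a regular sequence. A module with a
regular sequence of the length of `gs` is Cohen–Macaulay if `gs` cuts its support down to the closed
point. -/
theorem isWeaklyRegular_of_support {S : Type u} [CommRing S] [IsLocalRing S]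
    [IsNoetherianRing S] {gs : List S} : ∀ {M : Type u} [AddCommGroup M] [Module S M]
      [Module.Finite S M] [Nontrivial M] (_ : ∀ g ∈ gs, g ∈ maximalIdeal S)
      (_ : ∃ rs : List S, (∀ r ∈ rs, r ∈ maximalIdeal S) ∧ IsRegular M rs ∧
        rs.length = gs.length)
      (_ : ∀ q ∈ Module.support S M, (∀ g ∈ gs, g ∈ q.asIdeal) → q.asIdeal = maximalIdeal S),
      IsWeaklyRegular M gs := by
  induction gs with
  | nil => intros; exact IsWeaklyRegular.nil S _
  | cons g gs ih =>
    intro M _ _ _ _ hmem hrs h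
    have hg : g ∈ maximalIdeal S := hmem g (by simp)
    have hreg : IsSMulRegular M g := by
      by_contra hcon
      have hmem' : g ∈ {r : S | IsSMulRegular M r}ᶜ := hcon
      rw [← biUnion_associatedPrimes_eq_compl_regular] at hmem'
      obtain ⟨p, hp, hgp⟩ := Set.mem_iUnion₂.1 hmem'
      obtain ⟨rs, h1, h2, h3⟩ := hrs
      have hle := length_le_supportDim_of_mem_associatedPrimes h1 h2 hp
      have hge : Module.supportDim S (S ⧸ p) ≤ gs.length := by
        refine supportDim_le_length (fun r hr => hmem r (by simp [hr])) fun q hq hgs => ?_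
        rw [Module.mem_support_iff_of_finite, Ideal.annihilator_quotient] at hq
        refine h q ?_ (by simpa using ⟨hq hgp, hgs⟩)
        rw [Module.mem_support_iff_of_finite]
        exact (Submodule.annihilator_top (R := S) (M := M)).ge.trans (hp.annihilator_le.trans hq)
      have := hle.trans hge
      rw [h3, List.length_cons] at this
      have := Nat.cast_le.1
        (show ((gs.length + 1 : ℕ) : ℕ∞) ≤ (gs.length : ℕ∞) by exact_mod_cast this)
      omega
    rw [isWeaklyRegular_cons_iff]
    have := nontrivial_quotSMulTop_of_mem_maximalIdeal M hg
    refine ⟨hreg, ih (fun r hr => hmem r (by simp [hr]))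
      (exists_isRegular_quotSMulTop hg hreg (by simpa using hrs)) fun q hq hgs => ?_⟩
    rw [Module.support_quotSMulTop] at hq
    refine h q hq.1 ?_
    simpa using ⟨by simpa using hq.2, hgs⟩

end LocalRing

/-! ### Primes of a polynomial ring given by linear equations -/

section Specialize

variable {V : Type u} {K : Type w} [Field K]

open Classical in
/-- The substitution `X v ↦ a v` for `v ∈ D`, leaving the other indeterminates alone. Its kernel is
the prime ideal generated by the `X v - a v` with `v ∈ D`. -/
noncomputable def specialize (a : V → K) (D : Finset V) :
    MvPolynomial V K →ₐ[K] MvPolynomial V K :=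
  aeval fun v => if v ∈ D then C (a v) else X v

theorem X_sub_C_mem_ker_specialize (a : V → K) {D : Finset V} {v : V} :
    X v - C (a v) ∈ RingHom.ker (specialize a D) ↔ v ∈ D := by
  rw [RingHom.mem_ker, map_sub, specialize, aeval_X, aeval_C]
  split_ifs with h
  · simp [h, MvPolynomial.algebraMap_eq]
  · simp only [h, iff_false]
    intro h0
    have := congrArg (eval fun w => a w + 1) h0
    simp [MvPolynomial.algebraMap_eq] at this

instance (a : V → K) (D : Finset V) : (RingHom.ker (specialize a D)).IsPrime :=
  RingHom.ker_isPrime _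

theorem ker_specialize_le (a : V → K) {D : Finset V} {J : Ideal (MvPolynomial V K)}
    (h : ∀ v ∈ D, X v - C (a v) ∈ J) : RingHom.ker (specialize a D) ≤ J := by
  intro f hf
  have key : (Ideal.Quotient.mkₐ K J).comp (specialize a D) = Ideal.Quotient.mkₐ K J := by
    ext v
    simp only [AlgHom.comp_apply, specialize, aeval_X]
    split_ifs with hv
    · have := h v hv
      rw [← Ideal.Quotient.eq_zero_iff_mem, map_sub, sub_eq_zero] at this
      exact this.symm
    · rfl
  have h1 := DFunLike.congr_fun key f
  rw [AlgHom.comp_apply, (RingHom.mem_ker).1 hf, map_zero] at h1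
  exact Ideal.Quotient.eq_zero_iff_mem.1 h1.symm

theorem ker_specialize_mono (a : V → K) {D E : Finset V} (h : D ⊆ E) :
    RingHom.ker (specialize a D) ≤ RingHom.ker (specialize a E) :=
  ker_specialize_le a fun _ hv => (X_sub_C_mem_ker_specialize a).2 (h hv)

theorem ker_specialize_le_ker_eval (a : V → K) (D : Finset V) :
    RingHom.ker (specialize a D) ≤ RingHom.ker (eval a) :=
  ker_specialize_le a fun _ _ => by simp [RingHom.mem_ker]

/-- Modulo an ideal contained in the prime generated by the `X v - a v` with `v ∈ D`, adjoining the
`X v - a v` with `v ∈ E` one at a time gives a chain of primes of length `E.card`. -/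
theorem card_le_height_map_ker_specialize {Q : Type*} [CommRing Q] (π : MvPolynomial V K →+* Q)
    (hπ : Function.Surjective π) (a : V → K) {D : Finset V}
    (hD : RingHom.ker π ≤ RingHom.ker (specialize a D)) [DecidableEq V] {E : Finset V}
    (hE : Disjoint D E) :
    (E.card : ℕ∞) ≤ ((RingHom.ker (specialize a (D ∪ E))).map π).height := by
  induction E using Finset.induction_on with
  | empty => simp
  | insert v E hv ih =>
    rw [Finset.disjoint_insert_right] at hE
    have hle : ∀ E : Finset V, RingHom.ker π ≤ RingHom.ker (specialize a (D ∪ E)) := fun E =>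
      hD.trans (ker_specialize_mono a Finset.subset_union_left)
    have hprime : ∀ E : Finset V, ((RingHom.ker (specialize a (D ∪ E))).map π).IsPrime := fun E =>
      Ideal.map_isPrime_of_surjective hπ (hle E)
    have hcomap : ∀ E : Finset V, ((RingHom.ker (specialize a (D ∪ E))).map π).comap π =
        RingHom.ker (specialize a (D ∪ E)) := fun E => by
      rw [Ideal.comap_map_of_surjective' π hπ, sup_eq_left.2 (hle E)]
    have := hprime E
    have := hprime (insert v E)
    rw [Finset.card_insert_of_notMem hv]
    push_cast
    refine (add_le_add_left (ih hE.2) 1).trans ?_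
    apply Ideal.height_add_one_le_of_lt_of_isPrime
    refine lt_of_le_of_ne (Ideal.map_mono (ker_specialize_mono a (by grind))) fun heq => ?_
    have h1 := congrArg (Ideal.comap π) heq
    rw [hcomap, hcomap] at h1
    have h2 : X v - C (a v) ∈ RingHom.ker (specialize a (D ∪ insert v E)) :=
      (X_sub_C_mem_ker_specialize a).2 (by simp)
    rw [← h1, X_sub_C_mem_ker_specialize] at h2
    rcases Finset.mem_union.1 h2 with h2 | h2
    · exact hE.1 h2
    · exact hv h2

end Specialize

/-! ### The local ring of a Cohen–Macaulay quotient of a polynomial ring at a rational point -/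

open RingTheory.Sequence IsLocalRing in
/-- The properties that are needed of the local ring `S` of `K[V] / I` at a rational point `a`:
elements of `I` map to zero and functions vanishing at `a` to non-units; the images of the `X v - a
v` generate an ideal whose only prime is the maximal one; primes of the polynomial ring between `I`
and the ideal of `a` come from primes of `S`; maps that kill `I` and invert the functions not
vanishing at `a` factor through `S`; and the depth of `S` is at least the dimension of every
coordinate subspace through `a` in the zero locus of `I`. -/
theorem IsCohenMacaulay.exists_localRing_at_point {V : Type u} [Fintype V] [DecidableEq V]
    {K : Type w} [Field K]
    {I : Ideal (MvPolynomial V K)} (hCM : IsCohenMacaulay (MvPolynomial V K ⧸ I)) (a : V → K)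
    (hI : I ≤ RingHom.ker (eval a)) :
    ∃ (S : Type (max u w)) (_ : CommRing S) (_ : IsLocalRing S) (_ : IsNoetherianRing S)
      (φ : MvPolynomial V K →+* S),
      (∀ f ∈ I, φ f = 0) ∧ (∀ f, eval a f = 0 → φ f ∈ maximalIdeal S) ∧
      (∀ q : Ideal S, q.IsPrime → (∀ v, φ (X v - C (a v)) ∈ q) → q = maximalIdeal S) ∧
      (∀ P : Ideal (MvPolynomial V K), P.IsPrime → I ≤ P → P ≤ RingHom.ker (eval a) →
        ∃ q : Ideal S, q.IsPrime ∧ q.comap φ = P) ∧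
      (∀ (B : Type w) [CommRing B] (ψ : MvPolynomial V K →+* B), (∀ f ∈ I, ψ f = 0) →
        (∀ f, eval a f ≠ 0 → IsUnit (ψ f)) → ∃ ψ' : S →+* B, ψ'.comp φ = ψ) ∧
      ∃ rs : List S, (∀ r ∈ rs, r ∈ maximalIdeal S) ∧ IsRegular S rs ∧
        ∀ D : Finset V, I ≤ RingHom.ker (specialize a D) → Dᶜ.card ≤ rs.length := by
  let π := Ideal.Quotient.mk I
  have hπ : Function.Surjective π := Ideal.Quotient.mk_surjective
  have hker : RingHom.ker π = I := Ideal.mk_ker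
  have hmax : (RingHom.ker (eval a)).IsMaximal :=
    RingHom.ker_isMaximal_of_surjective _ fun c => ⟨C c, by simp⟩
  let m : Ideal (MvPolynomial V K ⧸ I) := (RingHom.ker (eval a)).map π
  have hmc : m.comap π = RingHom.ker (eval a) := by
    rw [Ideal.comap_map_of_surjective' π hπ, hker, sup_eq_left.2 hI]
  have hm : m.IsMaximal := by
    refine (Ideal.map_eq_top_or_isMaximal_of_surjective π hπ hmax).resolve_left fun h => ?_
    apply hmax.ne_top
    rw [← hmc, show m = ⊤ from h, Ideal.comap_top]
  obtain ⟨hN, rs, h1, h2, h3⟩ := hCM.2 m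
  let φ := (algebraMap (MvPolynomial V K ⧸ I) (Localization.AtPrime m)).comp π
  have hφmax : ∀ f, eval a f = 0 → φ f ∈ maximalIdeal (Localization.AtPrime m) := by
    intro f hf
    rw [← Localization.AtPrime.map_eq_maximalIdeal]
    exact Ideal.mem_map_of_mem _ (Ideal.mem_map_of_mem _ hf)
  refine ⟨Localization.AtPrime m, inferInstance, inferInstance, hN, φ, ?_, hφmax, ?_, ?_, ?_,
    rs, h1, h2, ?_⟩
  · intro f hf
    simp only [φ, RingHom.comp_apply, π, Ideal.Quotient.eq_zero_iff_mem.2 hf, map_zero]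
  · intro q hq hv
    have hle : RingHom.ker (eval a) ≤ q.comap φ := by
      have h4 : RingHom.ker (specialize a Finset.univ) ≤ q.comap φ :=
        ker_specialize_le a fun v _ => hv v
      intro f hf
      refine h4 ?_
      have h5 : (specialize a Finset.univ) = (Algebra.ofId K _).comp (aeval a) := by
        ext v
        simp [specialize, MvPolynomial.algebraMap_eq, Algebra.ofId_apply]
      rw [RingHom.mem_ker, h5, AlgHom.comp_apply, show aeval a f = eval a f from rfl,
        (RingHom.mem_ker).1 hf, map_zero]
    refine (IsLocalRing.eq_maximalIdeal ?_)
    have h6 : maximalIdeal (Localization.AtPrime m) ≤ q := by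
      rw [← Localization.AtPrime.map_eq_maximalIdeal, Ideal.map_le_iff_le_comap,
        Ideal.map_le_iff_le_comap]
      exact hle
    have h7 := (maximalIdeal.isMaximal (Localization.AtPrime m)).eq_of_le hq.ne_top h6
    exact h7 ▸ maximalIdeal.isMaximal (Localization.AtPrime m)
  · intro P hP hIP hPa
    have hPp : (P.map π).IsPrime := Ideal.map_isPrime_of_surjective hπ (by rwa [hker])
    have hPc : (P.map π).comap π = P := by
      rw [Ideal.comap_map_of_surjective' π hπ, hker, sup_eq_left.2 hIP]
    have hdisj : Disjoint (m.primeCompl : Set (MvPolynomial V K ⧸ I)) (P.map π) := by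
      rw [Set.disjoint_left]
      exact fun x hx hxP => hx (Ideal.map_mono hPa hxP)
    refine ⟨(P.map π).map (algebraMap _ (Localization.AtPrime m)),
      IsLocalization.isPrime_of_isPrime_disjoint m.primeCompl _ _ hPp hdisj, ?_⟩
    rw [← Ideal.comap_comap, ← Ideal.under_def,
      IsLocalization.under_map_of_isPrime_disjoint m.primeCompl _ hPp hdisj, hPc]
  · intro B _ ψ hψI hψ
    refine ⟨IsLocalization.lift (M := m.primeCompl) (g := Ideal.Quotient.lift I ψ hψI) ?_, ?_⟩
    · rintro ⟨y, hy⟩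
      obtain ⟨f, rfl⟩ := hπ y
      refine hψ f fun h0 => hy (Ideal.mem_map_of_mem _ h0)
    · refine RingHom.ext fun f => ?_
      simp only [φ, RingHom.comp_apply, IsLocalization.lift_eq]
      rfl
  · intro D hD
    have h4 := card_le_height_map_ker_specialize π hπ a (by rwa [hker])
      (disjoint_compl_right (a := D))
    have h5 : ((RingHom.ker (specialize a (D ∪ Dᶜ))).map π).height ≤ m.height :=
      Ideal.height_mono (Ideal.map_mono (ker_specialize_le_ker_eval a _))
    rw [IsLocalization.AtPrime.ringKrullDim_eq_height m] at h3
    have h6 : ((rs.length : ℕ∞) : WithBot ℕ∞) = (m.height : WithBot ℕ∞) := by exact_mod_cast h3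
    have h7 := (h4.trans h5).trans_eq (WithBot.coe_injective h6).symm
    exact_mod_cast h7

namespace SimpleGraph

/-! ### Well-covered sets of vertices -/

/-- `S` is maximal among the independent sets of vertices contained in `W`. -/
def IsMaxIndepIn {V : Type u} (G : SimpleGraph V) (W S : Finset V) : Prop :=
  Maximal (fun T : Finset V => T ⊆ W ∧ G.IsIndepSet (T : Set V)) S

/-- The subgraph induced on `W` is well-covered with independence number `k`: every maximal
independent subset of `W` has `k` elements. -/
def WellCoveredOn {V : Type u} (G : SimpleGraph V) (W : Finset V) (k : ℕ) : Prop :=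
  ∀ S, G.IsMaxIndepIn W S → S.card = k

variable {V : Type u} {G : SimpleGraph V}

theorem isMaxIndepIn_iff {W S : Finset V} : G.IsMaxIndepIn W S ↔
    S ⊆ W ∧ G.IsIndepSet (S : Set V) ∧ ∀ w ∈ W, w ∉ S → ∃ s ∈ S, G.Adj s w := by
  classical
  constructor
  · intro h
    refine ⟨h.1.1, h.1.2, fun w hw hwS => ?_⟩
    by_contra! hcon
    refine hwS (h.2 (y := insert w S) ⟨?_, ?_⟩ (Finset.subset_insert _ _)
      (Finset.mem_insert_self _ _))
    · exact Finset.insert_subset hw h.1.1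
    · rw [Finset.coe_insert]
      refine Set.Pairwise.insert h.1.2 fun s hs _ => ⟨fun h => hcon s hs h.symm, hcon s hs⟩
  · rintro ⟨h1, h2, h3⟩
    refine ⟨⟨h1, h2⟩, fun T hT hST w hw => ?_⟩
    by_contra hwS
    obtain ⟨s, hs, hadj⟩ := h3 w (hT.1 hw) hwS
    exact hT.2 (hST hs) hw hadj.ne hadj

theorem exists_isMaxIndepIn {W T : Finset V} (hTW : T ⊆ W) (hT : G.IsIndepSet (T : Set V)) :
    ∃ S, T ⊆ S ∧ G.IsMaxIndepIn W S := by
  classical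
  have hfin : {T : Finset V | T ⊆ W ∧ G.IsIndepSet (T : Set V)}.Finite :=
    (W.powerset.finite_toSet).subset fun T hT => by simpa using hT.1
  obtain ⟨S, hTS, hS⟩ := hfin.exists_le_maximal (a := T) ⟨hTW, hT⟩
  exact ⟨S, hTS, hS⟩

theorem WellCoveredOn.card_le {W T : Finset V} {k : ℕ} (h : G.WellCoveredOn W k) (hTW : T ⊆ W)
    (hT : G.IsIndepSet (T : Set V)) : T.card ≤ k := by
  obtain ⟨S, hTS, hS⟩ := exists_isMaxIndepIn hTW hT
  exact (Finset.card_le_card hTS).trans_eq (h S hS)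

/-! ### Cohen–Macaulay graphs are well-covered -/

theorem edgeIdeal_le_iff {K : Type w} [Field K] {J : Ideal (MvPolynomial V K)} :
    G.edgeIdeal K ≤ J ↔ ∀ x y, G.Adj x y → X x * X y ∈ J := by
  rw [edgeIdeal, Ideal.span_le]
  constructor
  · exact fun h x y hxy => h ⟨x, y, hxy, rfl⟩
  · rintro h _ ⟨x, y, hxy, rfl⟩
    exact h x y hxy

theorem X_mul_X_mem_edgeIdeal {K : Type w} [Field K] {x y : V} (h : G.Adj x y) :
    X x * X y ∈ G.edgeIdeal K := Ideal.subset_span ⟨x, y, h, rfl⟩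

theorem edgeIdeal_le_ker_specialize {K : Type w} [Field K] [Fintype V] [DecidableEq V]
    {T : Finset V} (hT : G.IsIndepSet (T : Set V)) {a : V → K} (ha : ∀ v ∉ T, a v = 0) :
    G.edgeIdeal K ≤ RingHom.ker (specialize a Tᶜ) := by
  have key : ∀ v ∉ T, X v ∈ RingHom.ker (specialize a Tᶜ) := fun v hv => by
    have := (X_sub_C_mem_ker_specialize a (D := Tᶜ) (v := v)).2 (by simpa using hv)
    rwa [ha v hv, C_0, sub_zero] at this
  refine edgeIdeal_le_iff.2 fun x y hxy => ?_
  by_cases hx : x ∈ T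
  · exact Ideal.mul_mem_left _ _ (key y fun hy => hT hx hy hxy.ne hxy)
  · exact Ideal.mul_mem_right _ _ (key x hx)

open IsLocalRing in
/-- In the local ring at the origin, the coordinate subspace of a maximal independent set `T` is a
component of the zero locus, so its dimension `T.card` is at least the depth; by Cohen–Macaulayness
it is also at most the depth. -/
theorem exists_wellCoveredOn_univ {K : Type w} [Field K] [Fintype V]
    (hCM : IsCohenMacaulay (MvPolynomial V K ⧸ G.edgeIdeal K)) :
    ∃ k, G.WellCoveredOn Finset.univ k := by
  classical
  have hsub : ∀ {T : Finset V}, G.IsIndepSet (T : Set V) →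
      G.edgeIdeal K ≤ RingHom.ker (specialize (0 : V → K) Tᶜ) := fun hT =>
    edgeIdeal_le_ker_specialize hT fun _ _ => rfl
  have h0 : G.edgeIdeal K ≤ RingHom.ker (eval (0 : V → K)) :=
    (hsub (T := ∅) (by simp)).trans (ker_specialize_le_ker_eval _ _)
  obtain ⟨S, _, _, _, φ, hI, hmax, hq, hlift, -, rs, hrs1, hrs2, hdim⟩ :=
    hCM.exists_localRing_at_point 0 h0
  refine ⟨rs.length, fun T hT => le_antisymm ?_ ?_⟩
  · simpa using hdim Tᶜ (hsub hT.1.2)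
  -- a minimal prime of `S` below the prime generated by the variables outside `T`
  obtain ⟨Q, hQ, hQc⟩ := hlift _ inferInstance (hsub hT.1.2) (ker_specialize_le_ker_eval _ _)
  obtain ⟨p, hp, hpQ⟩ := Ideal.exists_minimalPrimes_le (bot_le : (⊥ : Ideal S) ≤ Q)
  have hpp : p.IsPrime := hp.1.1
  have hpT : ∀ v ∉ T, φ (X v) ∈ p := by
    intro v hv
    obtain ⟨s, hs, hsv⟩ := (isMaxIndepIn_iff.1 hT).2.2 v (Finset.mem_univ v) hv
    have hmem : φ (X s) * φ (X v) ∈ p := by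
      rw [← map_mul, hI _ (X_mul_X_mem_edgeIdeal hsv)]
      exact p.zero_mem
    refine (hpp.mem_or_mem hmem).resolve_left fun hsp => ?_
    have h1 : (X s : MvPolynomial V K) - C ((0 : V → K) s) ∈ Q.comap φ := by
      simpa using hpQ hsp
    rw [hQc, X_sub_C_mem_ker_specialize] at h1
    exact (Finset.mem_compl.1 h1) hs
  have hass : p ∈ associatedPrimes S S := by
    apply Module.associatedPrimes.minimalPrimes_annihilator_subset_associatedPrimes S S
    rwa [Module.annihilator_eq_bot.2 inferInstance]
  have h1 := length_le_supportDim_of_mem_associatedPrimes hrs1 hrs2 hass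
  have h2 : Module.supportDim S (S ⧸ p) ≤ (T.toList.map fun v => φ (X v)).length := by
    refine supportDim_le_length ?_ ?_
    · simp only [List.mem_map, forall_exists_index, and_imp]
      rintro _ v - rfl
      exact hmax _ (by simp)
    · intro q hqs hgs
      rw [Module.mem_support_iff_of_finite, Ideal.annihilator_quotient] at hqs
      refine hq _ q.2 fun v => ?_
      simp only [Pi.zero_apply, C_0, sub_zero]
      by_cases hv : v ∈ T
      · exact hgs _ (List.mem_map.2 ⟨v, by simpa using hv, rfl⟩)
      · exact hqs (hpT v hv)
  have h3 := h1.trans h2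
  rw [List.length_map, Finset.length_toList] at h3
  exact_mod_cast h3

/-! ### Links in Cohen–Macaulay graphs -/

/-- `W` is the set of vertices outside the closed neighbourhood of the independent set `F`. The
induced subgraph on `W` has the link of `F` as its independence complex. -/
structure IsLink (G : SimpleGraph V) (F W : Finset V) : Prop where
  isIndepSet : G.IsIndepSet (F : Set V)
  mem_iff : ∀ v, v ∈ W ↔ v ∉ F ∧ ∀ f ∈ F, ¬ G.Adj f v

theorem IsLink.exists_adj {F W : Finset V} (h : G.IsLink F W) {v : V} (hF : v ∉ F) (hW : v ∉ W) :
    ∃ f ∈ F, G.Adj f v := by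
  by_contra! hcon
  exact hW ((h.mem_iff v).2 ⟨hF, hcon⟩)

open RingTheory.Sequence IsLocalRing in
open scoped Pointwise in
/-- A test for Cohen–Macaulayness at the point whose coordinates are the indicator function of `F`,
where the local ring is that of the edge ring of the link `W` up to extra invertible variables. If
`θ` followed by `θ'` is a system of parameters of the edge ring of `W`, then it is a regular
sequence together with the `X f - 1` for `f ∈ F`, so a relation `θ' * t ∈ (θ) + I(G)` forces `t ∈
(θ) + I(G)` locally. Such a `t` is killed by every map `ψ` to a local algebra that kills `θ` and the
edges, and here the double dual numbers are the test algebra. The conclusion contradicts an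
independent computation of `ψ t` in the applications. -/
theorem IsLink.false_of_syzygy {K : Type w} [Field K] [Fintype V] [DecidableEq V]
    (hCM : IsCohenMacaulay (MvPolynomial V K ⧸ G.edgeIdeal K)) {F W T : Finset V}
    (h : G.IsLink F W) (hTW : T ⊆ W) (hT : G.IsIndepSet (T : Set V))
    (θ : List (MvPolynomial V K)) (θ' t : MvPolynomial V K) (hlen : θ.length + 1 = T.card)
    (hθ : ∀ g ∈ θ, g ∈ Ideal.span (X '' (W : Set V)))
    (hθ' : θ' ∈ Ideal.span (X '' (W : Set V)))
    (hprime : ∀ P : Ideal (MvPolynomial V K), P.IsPrime →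
      (∀ x ∈ W, ∀ y ∈ W, G.Adj x y → X x * X y ∈ P) → (∀ g ∈ θ, g ∈ P) → θ' ∈ P →
        ∀ x ∈ W, X x ∈ P)
    (hsyz : θ' * t ∈ Ideal.ofList θ ⊔ G.edgeIdeal K)
    (b : V → DualNumber (DualNumber K))
    (hb : ∀ x ∈ W, ∀ y ∈ W, G.Adj x y → b x * b y = 0) (hb0 : ∀ x ∈ W, (b x).fst.fst = 0)
    (ψ : MvPolynomial V K →ₐ[K] DualNumber (DualNumber K))
    (hψ : ψ = aeval fun v => if v ∈ F then 1 else if v ∈ W then b v else 0)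
    (hψθ : ∀ g ∈ θ, ψ g = 0) : ψ t = 0 := by
  have hFW : Disjoint F W := Finset.disjoint_left.2 fun v hF hW => ((h.mem_iff v).1 hW).1 hF
  -- the rational point whose coordinates are the indicator function of `F`
  let a : V → K := fun v => if v ∈ F then 1 else 0
  have hFT : G.IsIndepSet ((F ∪ T : Finset V) : Set V) := by
    rintro x hx y hy hne hadj
    simp only [Finset.coe_union, Set.mem_union, Finset.mem_coe] at hx hy
    rcases hx with hx | hx <;> rcases hy with hy | hy
    · exact h.isIndepSet hx hy hne hadj
    · exact ((h.mem_iff y).1 (hTW hy)).2 x hx hadj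
    · exact ((h.mem_iff x).1 (hTW hx)).2 y hy hadj.symm
    · exact hT hx hy hne hadj
  have hsub : G.edgeIdeal K ≤ RingHom.ker (specialize a (F ∪ T)ᶜ) :=
    edgeIdeal_le_ker_specialize hFT fun v hv => if_neg fun hF => hv (Finset.mem_union_left _ hF)
  obtain ⟨S, _, _, _, φ, hI, hmax, hq, -, hext, rs, hrs1, hrs2, hdim⟩ :=
    hCM.exists_localRing_at_point a (hsub.trans (ker_specialize_le_ker_eval _ _))
  have hWa : Ideal.span (X '' (W : Set V)) ≤ RingHom.ker (eval a) := by
    rw [Ideal.span_le]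
    rintro _ ⟨v, hv, rfl⟩
    simp only [SetLike.mem_coe, RingHom.mem_ker, eval_X, a]
    exact if_neg fun hF => Finset.disjoint_left.1 hFW hF hv
  -- the system of parameters
  let L : List (MvPolynomial V K) := F.toList.map fun f => X f - 1
  let gs : List S := (L ++ θ).map φ ++ [φ θ']
  have hgslen : gs.length ≤ rs.length := by
    have h1 := hdim _ hsub
    rw [compl_compl, Finset.card_union_of_disjoint (hFW.mono_right hTW)] at h1
    simp only [gs, L, List.length_append, List.length_map, Finset.length_toList,
      List.length_singleton]
    omega
  have hLa : ∀ g ∈ L ++ θ, eval a g = 0 := by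
    intro g hg
    rcases List.mem_append.1 hg with hg | hg
    · obtain ⟨f, hf, rfl⟩ := List.mem_map.1 hg
      simp [a, (Finset.mem_toList.1 hf)]
    · exact hWa (hθ g hg)
  have hgs : ∀ g ∈ gs, g ∈ maximalIdeal S := by
    intro g hg
    rcases List.mem_append.1 hg with hg | hg
    · obtain ⟨f, hf, rfl⟩ := List.mem_map.1 hg
      exact hmax _ (hLa f hf)
    · rw [List.mem_singleton.1 hg]
      exact hmax _ (hWa hθ')
  have hreg : IsWeaklyRegular S gs := by
    refine isWeaklyRegular_of_support hgs ⟨rs.take gs.length,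
      fun r hr => hrs1 r (List.mem_of_mem_take hr), ?_, by simpa using hgslen⟩ ?_
    · refine IsRegular.of_isWeaklyRegular_of_mem_maximalIdeal S
        (fun r hr => hrs1 r (List.mem_of_mem_take hr)) ?_
      have h1 := hrs2.1
      rw [← List.take_append_drop gs.length rs, isWeaklyRegular_append_iff] at h1
      exact h1.1
    · intro q _ hqgs
      have hqp := q.2
      have hF : ∀ f ∈ F, φ (X f) - 1 ∈ q.asIdeal := fun f hf => by
        refine hqgs _ (List.mem_append_left _ (List.mem_map.2 ⟨X f - 1, ?_, by simp⟩))
        exact List.mem_append_left _ (List.mem_map.2 ⟨f, by simpa using hf, rfl⟩)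
      have hqI : G.edgeIdeal K ≤ q.asIdeal.comap φ := fun f hf => by
        rw [Ideal.mem_comap, hI f hf]; exact q.asIdeal.zero_mem
      have hW := hprime (q.asIdeal.comap φ) inferInstance
        (fun x _ y _ hxy => hqI (X_mul_X_mem_edgeIdeal hxy))
        (fun g hg => hqgs _ (List.mem_append_left _
          (List.mem_map.2 ⟨g, List.mem_append_right _ hg, rfl⟩)))
        (hqgs _ (List.mem_append_right _ (by simp)))
      refine hq _ hqp fun v => ?_
      by_cases hvF : v ∈ F
      · simpa [a, hvF] using hF v hvF
      · simp only [a, if_neg hvF, C_0, sub_zero]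
        by_cases hvW : v ∈ W
        · exact hW v hvW
        · obtain ⟨f, hf, hadj⟩ := h.exists_adj hvF hvW
          have h1 : φ (X f) * φ (X v) ∈ q.asIdeal := by
            rw [← map_mul]; exact hqI (X_mul_X_mem_edgeIdeal hadj)
          refine (hqp.mem_or_mem h1).resolve_left fun h2 => hqp.ne_top ?_
          rw [Ideal.eq_top_iff_one]
          simpa using q.asIdeal.sub_mem h2 (hF f hf)
  rw [isWeaklyRegular_append_iff] at hreg
  have hlast := (isWeaklyRegular_singleton_iff _ _).1 hreg.2
  rw [isSMulRegular_quotient_iff_mem_of_smul_mem] at hlast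
  have htmem : φ t ∈ Ideal.ofList ((L ++ θ).map φ) := by
    have h1 := hlast (φ t) ?_
    · simpa using h1
    have h2 : φ (θ' * t) ∈ Ideal.ofList (θ.map φ) := by
      obtain ⟨p, hp, r, hr, hpr⟩ := Submodule.mem_sup.1 hsyz
      rw [← hpr, map_add, hI r hr, add_zero, ← Ideal.map_ofList]
      exact Ideal.mem_map_of_mem _ hp
    have h3 : Ideal.ofList (θ.map φ) ≤ Ideal.ofList ((L ++ θ).map φ) := by
      rw [List.map_append, Ideal.ofList_append]
      exact le_sup_right
    simpa using h3 h2
  -- evaluation in the test ring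
  have hψI : ∀ f ∈ G.edgeIdeal K, ψ f = 0 := by
    have : G.edgeIdeal K ≤ RingHom.ker ψ := by
      refine edgeIdeal_le_iff.2 fun x y hxy => ?_
      rw [RingHom.mem_ker, map_mul, hψ, aeval_X, aeval_X]
      by_cases hxF : x ∈ F
      · have hyF : y ∉ F := fun hy => h.isIndepSet hxF hy hxy.ne hxy
        have hyW : y ∉ W := fun hy => ((h.mem_iff y).1 hy).2 x hxF hxy
        simp [hyF, hyW]
      · by_cases hyF : y ∈ F
        · have hxW : x ∉ W := fun hx => ((h.mem_iff x).1 hx).2 y hyF hxy.symm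
          simp [hxF, hxW]
        · simp only [if_neg hxF, if_neg hyF]
          split_ifs with h1 h2
          · exact hb x h1 y h2 hxy
          all_goals simp
    exact this
  have hψfst : ∀ f, (ψ f).fst.fst = eval a f := by
    have h1 : ((TrivSqZeroExt.fstHom K K K).comp
        ((TrivSqZeroExt.fstHom (DualNumber K) (DualNumber K) (DualNumber K)).restrictScalars K)).comp
        ψ = aeval a := by
      ext v
      simp only [AlgHom.comp_apply, hψ, aeval_X, AlgHom.coe_restrictScalars', a,
        TrivSqZeroExt.fstHom_apply]
      by_cases hF : v ∈ F
      · simp [hF]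
      · by_cases hW : v ∈ W
        · simp [hF, hW, hb0 v hW]
        · simp [hF, hW]
    intro f
    exact DFunLike.congr_fun h1 f
  obtain ⟨ψ', hψ'⟩ := hext (DualNumber (DualNumber K)) ψ.toRingHom hψI fun f hf => by
    change IsUnit (ψ f)
    rw [TrivSqZeroExt.isUnit_iff_isUnit_fst, TrivSqZeroExt.isUnit_iff_isUnit_fst, hψfst]
    exact isUnit_iff_ne_zero.2 hf
  have hψ'f : ∀ f, ψ' (φ f) = ψ f := fun f => DFunLike.congr_fun hψ' f
  have hle : Ideal.ofList ((L ++ θ).map φ) ≤ RingHom.ker ψ' := by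
    rw [Ideal.ofList, Ideal.span_le]
    intro g hg
    obtain ⟨f, hf, rfl⟩ := List.mem_map.1 (show g ∈ (L ++ θ).map φ from hg)
    rw [SetLike.mem_coe, RingHom.mem_ker, hψ'f]
    rcases List.mem_append.1 hf with hf | hf
    · obtain ⟨v, hv, rfl⟩ := List.mem_map.1 hf
      have hv : v ∈ F := by simpa using hv
      simp [hψ, hv]
    · exact hψθ f hf
  rw [← hψ'f]
  exact hle htmem

/-- The subgraph induced on `W` is a cycle of length `n`, whose consecutive vertices are
`z 0, …, z (n - 1)`. The values `z i` for `i ≥ n` are irrelevant. -/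
structure IsCycleOn (G : SimpleGraph V) (W : Finset V) (n : ℕ) (z : ℕ → V) : Prop where
  mem_iff : ∀ v, v ∈ W ↔ ∃ i < n, z i = v
  inj : ∀ i < n, ∀ j < n, z i = z j → i = j
  adj_iff : ∀ i j, i < j → j < n → (G.Adj (z i) (z j) ↔ j = i + 1 ∨ (i = 0 ∧ j + 1 = n))

theorem IsCycleOn.mem {W : Finset V} {n : ℕ} {z : ℕ → V} (h : G.IsCycleOn W n z) {i : ℕ}
    (hi : i < n) : z i ∈ W := (h.mem_iff _).2 ⟨i, hi, rfl⟩

theorem IsCycleOn.adj_succ {W : Finset V} {n : ℕ} {z : ℕ → V} (h : G.IsCycleOn W n z) {i : ℕ}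
    (hi : i + 1 < n) : G.Adj (z i) (z (i + 1)) :=
  (h.adj_iff i (i + 1) (by omega) hi).2 (Or.inl rfl)

theorem IsCycleOn.adj_zero {W : Finset V} {n : ℕ} {z : ℕ → V} (h : G.IsCycleOn W (n + 1) z)
    (hn : 0 < n) : G.Adj (z n) (z 0) :=
  ((h.adj_iff 0 n hn (by omega)).2 (Or.inr ⟨rfl, rfl⟩)).symm

theorem IsCycleOn.isIndepSet {W : Finset V} {n : ℕ} {z : ℕ → V} (h : G.IsCycleOn W n z)
    {s : Finset ℕ} [DecidableEq V] (hs : ∀ i ∈ s, i < n)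
    (hs' : ∀ i ∈ s, ∀ j ∈ s, i < j → j ≠ i + 1 ∧ (i = 0 → j + 1 ≠ n)) :
    G.IsIndepSet (s.image z : Set V) := by
  have key : ∀ i ∈ s, ∀ j ∈ s, i < j → ¬ G.Adj (z i) (z j) := by
    intro i hi j hj hij hadj
    rw [h.adj_iff i j hij (hs j hj)] at hadj
    have := hs' i hi j hj hij
    tauto
  rintro x hx y hy hne hadj
  simp only [Finset.coe_image, Set.mem_image, Finset.mem_coe] at hx hy
  obtain ⟨i, hi, rfl⟩ := hx
  obtain ⟨j, hj, rfl⟩ := hy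
  rcases lt_trichotomy i j with hij | rfl | hij
  · exact key i hi j hj hij hadj
  · exact hne rfl
  · exact key j hj i hi hij hadj.symm

theorem IsCycleOn.card_image {W : Finset V} {n : ℕ} {z : ℕ → V} (h : G.IsCycleOn W n z)
    {s : Finset ℕ} [DecidableEq V] (hs : ∀ i ∈ s, i < n) : (s.image z).card = s.card :=
  Finset.card_image_of_injOn fun i hi j hj hij => h.inj i (hs i hi) j (hs j hj) hij

/-- Transport of the criterion `IsLink.false_of_syzygy` along the labelling of a cycle. -/
theorem IsLink.false_of_cycle {K : Type w} [Field K] [Fintype V]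
    (hCM : IsCohenMacaulay (MvPolynomial V K ⧸ G.edgeIdeal K)) {F W : Finset V}
    (h : G.IsLink F W) {n : ℕ} {z : ℕ → V} (hz : G.IsCycleOn W n z) (s : Finset ℕ)
    (hs : ∀ i ∈ s, i < n)
    (hs' : ∀ i ∈ s, ∀ j ∈ s, i < j → j ≠ i + 1 ∧ (i = 0 → j + 1 ≠ n))
    (θ : List (MvPolynomial V K)) (θ' t : MvPolynomial V K) (hlen : θ.length + 1 = s.card)
    (hθ : ∀ J : Ideal (MvPolynomial V K), (∀ i < n, X (z i) ∈ J) → (∀ g ∈ θ, g ∈ J) ∧ θ' ∈ J)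
    (hprime : ∀ P : Ideal (MvPolynomial V K), P.IsPrime →
      (∀ x ∈ W, ∀ y ∈ W, G.Adj x y → X x * X y ∈ P) → (∀ g ∈ θ, g ∈ P) → θ' ∈ P →
        ∀ i < n, X (z i) ∈ P)
    (hsyz : θ' * t ∈ Ideal.ofList θ ⊔ G.edgeIdeal K)
    (β : ℕ → DualNumber (DualNumber K))
    (hβ : ∀ i j, i < j → j < n → j = i + 1 ∨ (i = 0 ∧ j + 1 = n) → β i * β j = 0)
    (hβ0 : ∀ i < n, (β i).fst.fst = 0)
    (hψ : ∀ ψ : MvPolynomial V K →ₐ[K] DualNumber (DualNumber K),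
      (∀ i < n, ψ (X (z i)) = β i) → (∀ g ∈ θ, ψ g = 0) ∧ ψ t ≠ 0) : False := by
  classical
  let b : V → DualNumber (DualNumber K) := fun v => ∑ i ∈ Finset.range n, if z i = v then β i else 0
  have hb : ∀ i < n, b (z i) = β i := by
    intro i hi
    simp only [b]
    rw [Finset.sum_eq_single i, if_pos rfl]
    · intro j hj hji
      exact if_neg fun h => hji (hz.inj j (Finset.mem_range.1 hj) i hi h)
    · intro h
      exact absurd (Finset.mem_range.2 hi) h
  have hbb : ∀ i j, i < j → j < n → G.Adj (z i) (z j) → b (z i) * b (z j) = 0 := by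
    intro i j hij hj hadj
    rw [hb i (hij.trans hj), hb j hj]
    exact hβ i j hij hj ((hz.adj_iff i j hij hj).1 hadj)
  have hmem := hθ (Ideal.span (X '' (W : Set V))) fun i hi =>
    Ideal.subset_span ⟨z i, hz.mem hi, rfl⟩
  have hψ0 := hψ (aeval fun v => if v ∈ F then 1 else if v ∈ W then b v else 0) fun i hi => by
    have hF : z i ∉ F := ((h.mem_iff _).1 (hz.mem hi)).1
    rw [aeval_X, if_neg hF, if_pos (hz.mem hi), hb i hi]
  refine hψ0.2 (h.false_of_syzygy hCM (T := s.image z) ?_ (hz.isIndepSet hs hs') θ θ' t ?_ hmem.1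
    hmem.2 ?_ hsyz b ?_ ?_ _ rfl hψ0.1)
  · intro v hv
    obtain ⟨i, hi, rfl⟩ := Finset.mem_image.1 hv
    exact hz.mem (hs i hi)
  · rw [hz.card_image hs, hlen]
  · intro P hP h1 h2 h3 x hx
    obtain ⟨i, hi, rfl⟩ := (hz.mem_iff x).1 hx
    exact hprime P hP h1 h2 h3 i hi
  · intro x hx y hy hadj
    obtain ⟨i, hi, rfl⟩ := (hz.mem_iff x).1 hx
    obtain ⟨j, hj, rfl⟩ := (hz.mem_iff y).1 hy
    rcases lt_trichotomy i j with hij | rfl | hij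
    · exact hbb i j hij hj hadj
    · exact absurd rfl hadj.ne
    · exact (mul_comm (b (z i)) (b (z j))).trans (hbb j i hij hi hadj.symm)
  · intro x hx
    obtain ⟨i, hi, rfl⟩ := (hz.mem_iff x).1 hx
    rw [hb i hi]
    exact hβ0 i hi

/-- The linear forms `y₀ + y₁ + y₂ + y₃` and `y₀ + y₁` are a system of parameters of the edge ring
of the four-cycle. -/
theorem eq_zero_of_four_cycle {D : Type*} [CommRing D] [IsDomain D] {y₀ y₁ y₂ y₃ : D}
    (h₀₁ : y₀ * y₁ = 0) (h₂₃ : y₂ * y₃ = 0) (hθ : y₀ + y₁ + y₂ + y₃ = 0) (hθ' : y₀ + y₁ = 0) :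
    y₀ = 0 ∧ y₁ = 0 ∧ y₂ = 0 ∧ y₃ = 0 := by
  have h0 : y₀ = 0 := pow_eq_zero_iff two_ne_zero |>.1 (by linear_combination y₀ * hθ' - h₀₁)
  have h2 : y₂ = 0 := pow_eq_zero_iff two_ne_zero |>.1
    (by linear_combination y₂ * (hθ - hθ') - h₂₃)
  subst h0 h2
  have h1 : y₁ = 0 := by simpa using hθ'
  subst h1
  exact ⟨rfl, rfl, rfl, by simpa using hθ⟩

/-- The three given linear forms are a system of parameters of the edge ring of the seven-cycle. -/
theorem eq_zero_of_seven_cycle {D : Type*} [CommRing D] [IsDomain D]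
    {y₀ y₁ y₂ y₃ y₄ y₅ y₆ : D} (h₀₁ : y₀ * y₁ = 0) (h₁₂ : y₁ * y₂ = 0) (h₂₃ : y₂ * y₃ = 0)
    (h₃₄ : y₃ * y₄ = 0) (h₄₅ : y₄ * y₅ = 0) (h₅₆ : y₅ * y₆ = 0) (h₆₀ : y₆ * y₀ = 0)
    (hA : y₀ + y₁ + y₂ = 0) (hB : y₅ + y₆ + y₂ = 0) (hC : y₃ + y₄ + y₂ = 0) :
    y₀ = 0 ∧ y₁ = 0 ∧ y₂ = 0 ∧ y₃ = 0 ∧ y₄ = 0 ∧ y₅ = 0 ∧ y₆ = 0 := by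
  have h1 : y₁ = 0 := pow_eq_zero_iff two_ne_zero |>.1
    (by linear_combination y₁ * hA - h₀₁ - h₁₂)
  subst h1
  have h6 : y₆ = 0 := pow_eq_zero_iff two_ne_zero |>.1
    (by linear_combination y₆ * hB - h₅₆ - y₆ * hA + h₆₀)
  subst h6
  have h4 : y₄ = 0 := pow_eq_zero_iff two_ne_zero |>.1
    (by linear_combination y₄ * hC - h₃₄ - y₄ * hB + h₄₅)
  subst h4
  have h2 : y₂ = 0 := pow_eq_zero_iff two_ne_zero |>.1
    (by linear_combination y₂ * hC - h₂₃)
  subst h2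
  exact ⟨by simpa using hA, rfl, rfl, by simpa using hC, rfl, by simpa using hB, rfl⟩

/-- The four-cycle is not Cohen–Macaulay: modulo `θ = y₀ + y₁ + y₂ + y₃` one has `(y₀ + y₁) * (y₀ +
y₂) = y₁ * y₂ - y₃ * y₀ = 0`, although `y₀ + y₂` does not vanish under `y₀ = ε`, `y₁ = -ε`, `y₂ = y₃
= 0`. -/
theorem IsLink.not_isCycleOn_four {K : Type w} [Field K] [Fintype V]
    (hCM : IsCohenMacaulay (MvPolynomial V K ⧸ G.edgeIdeal K)) {F W : Finset V}
    (h : G.IsLink F W) {z : ℕ → V} : ¬ G.IsCycleOn W 4 z := by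
  intro hz
  have m := fun i (hi : i < 4) => hz.mem hi
  have e01 : G.Adj (z 0) (z 1) := hz.adj_succ (by norm_num)
  have e12 : G.Adj (z 1) (z 2) := hz.adj_succ (by norm_num)
  have e23 : G.Adj (z 2) (z 3) := hz.adj_succ (by norm_num)
  have e30 : G.Adj (z 3) (z 0) := hz.adj_zero (by norm_num)
  let ε : DualNumber (DualNumber K) := DualNumber.eps
  have hε : ε * ε = 0 := DualNumber.eps_mul_eps
  have hε0 : ε ≠ 0 := fun h0 => one_ne_zero (α := DualNumber K) (congrArg TrivSqZeroExt.snd h0)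
  refine h.false_of_cycle hCM hz {0, 2} (by decide) (by decide)
    [X (z 0) + X (z 1) + X (z 2) + X (z 3)] (X (z 0) + X (z 1)) (X (z 0) + X (z 2)) (by rfl) ?_ ?_
    ?_ (fun i => if i = 0 then ε else if i = 1 then -ε else 0) ?_ ?_ ?_
  · intro J hJ
    have h0 := hJ 0 (by norm_num)
    have h1 := hJ 1 (by norm_num)
    have h2 := hJ 2 (by norm_num)
    have h3 := hJ 3 (by norm_num)
    simp only [List.mem_singleton, forall_eq]
    exact ⟨J.add_mem (J.add_mem (J.add_mem h0 h1) h2) h3, J.add_mem h0 h1⟩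
  · intro P hP hE hθ hθ' i hi
    have f01 := hE _ (m 0 (by norm_num)) _ (m 1 (by norm_num)) e01
    have f23 := hE _ (m 2 (by norm_num)) _ (m 3 (by norm_num)) e23
    simp only [List.mem_singleton, forall_eq] at hθ
    rw [← Ideal.Quotient.eq_zero_iff_mem] at f01 f23 hθ hθ'
    simp only [map_add, map_mul] at f01 f23 hθ hθ'
    obtain ⟨h0, h1, h2, h3⟩ := eq_zero_of_four_cycle f01 f23 hθ hθ'
    rw [← Ideal.Quotient.eq_zero_iff_mem]
    interval_cases i <;> assumption
  · rw [Ideal.ofList_singleton]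
    have q01 := X_mul_X_mem_edgeIdeal (K := K) e01
    have q12 := X_mul_X_mem_edgeIdeal (K := K) e12
    have q30 := X_mul_X_mem_edgeIdeal (K := K) e30
    refine Submodule.mem_sup.2 ⟨X (z 0) * (X (z 0) + X (z 1) + X (z 2) + X (z 3)),
      Ideal.mul_mem_left _ _ (Ideal.mem_span_singleton_self _),
      X (z 1) * X (z 2) - X (z 3) * X (z 0),
      Ideal.sub_mem _ q12 q30, by ring⟩
  · intro i j hij hj hadj
    interval_cases j <;> interval_cases i <;> simp_all
  · intro i hi
    interval_cases i <;> simp [ε]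
  · intro ψ hψ
    have g0 := hψ 0 (by norm_num)
    have g1 := hψ 1 (by norm_num)
    have g2 := hψ 2 (by norm_num)
    have g3 := hψ 3 (by norm_num)
    simp [g0, g1, g2, g3, hε0]

/-- The seven-cycle is not Cohen–Macaulay if `2 ≠ 0`: modulo two of the linear forms of
`eq_zero_of_seven_cycle`, the third kills `y₁ * y₆`, which does not vanish in the double dual
numbers under `y₁ = 2ε`, `y₂ = -2ε`, `y₅ = ε - δ`, `y₆ = ε + δ`, all others being zero. -/
theorem IsLink.not_isCycleOn_seven {K : Type w} [Field K] (hK : (2 : K) ≠ 0) [Fintype V]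
    (hCM : IsCohenMacaulay (MvPolynomial V K ⧸ G.edgeIdeal K)) {F W : Finset V}
    (h : G.IsLink F W) {z : ℕ → V} : ¬ G.IsCycleOn W 7 z := by
  intro hz
  have m := fun i (hi : i < 7) => hz.mem hi
  have e01 : G.Adj (z 0) (z 1) := hz.adj_succ (by norm_num)
  have e12 : G.Adj (z 1) (z 2) := hz.adj_succ (by norm_num)
  have e23 : G.Adj (z 2) (z 3) := hz.adj_succ (by norm_num)
  have e34 : G.Adj (z 3) (z 4) := hz.adj_succ (by norm_num)
  have e45 : G.Adj (z 4) (z 5) := hz.adj_succ (by norm_num)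
  have e56 : G.Adj (z 5) (z 6) := hz.adj_succ (by norm_num)
  have e60 : G.Adj (z 6) (z 0) := hz.adj_zero (by norm_num)
  let ε : DualNumber (DualNumber K) := DualNumber.eps
  let δ : DualNumber (DualNumber K) := TrivSqZeroExt.inl DualNumber.eps
  have hε : ε * ε = 0 := DualNumber.eps_mul_eps
  have hδ : δ * δ = 0 := by simp [δ, ← TrivSqZeroExt.inl_mul]
  have hεδ : (2 * ε) * (ε + δ) ≠ 0 := by
    intro h0
    have h1 : ε * δ + ε * δ = 0 := by linear_combination h0 - 2 * hε
    have h2 : (1 : K) + 1 = 0 := by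
      simpa [ε, δ] using congrArg TrivSqZeroExt.snd (congrArg TrivSqZeroExt.snd h1)
    exact hK (by rw [← one_add_one_eq_two]; exact h2)
  refine h.false_of_cycle hCM hz {0, 2, 4} (by decide) (by decide)
    [X (z 0) + X (z 1) + X (z 2), X (z 5) + X (z 6) + X (z 2)] (X (z 3) + X (z 4) + X (z 2))
    (X (z 1) * X (z 6)) (by rfl) ?_ ?_ ?_
    (fun i => if i = 1 then 2 * ε else if i = 2 then -(2 * ε) else if i = 5 then ε - δ else
      if i = 6 then ε + δ else 0) ?_ ?_ ?_
  · intro J hJ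
    have h0 := hJ 0 (by norm_num)
    have h1 := hJ 1 (by norm_num)
    have h2 := hJ 2 (by norm_num)
    have h3 := hJ 3 (by norm_num)
    have h4 := hJ 4 (by norm_num)
    have h5 := hJ 5 (by norm_num)
    have h6 := hJ 6 (by norm_num)
    simp only [List.mem_cons, List.not_mem_nil, or_false, forall_eq_or_imp, forall_eq]
    exact ⟨⟨J.add_mem (J.add_mem h0 h1) h2, J.add_mem (J.add_mem h5 h6) h2⟩,
      J.add_mem (J.add_mem h3 h4) h2⟩
  · intro P hP hE hθ hθ' i hi
    have f01 := hE _ (m 0 (by norm_num)) _ (m 1 (by norm_num)) e01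
    have f12 := hE _ (m 1 (by norm_num)) _ (m 2 (by norm_num)) e12
    have f23 := hE _ (m 2 (by norm_num)) _ (m 3 (by norm_num)) e23
    have f34 := hE _ (m 3 (by norm_num)) _ (m 4 (by norm_num)) e34
    have f45 := hE _ (m 4 (by norm_num)) _ (m 5 (by norm_num)) e45
    have f56 := hE _ (m 5 (by norm_num)) _ (m 6 (by norm_num)) e56
    have f60 := hE _ (m 6 (by norm_num)) _ (m 0 (by norm_num)) e60
    simp only [List.mem_cons, List.not_mem_nil, or_false, forall_eq_or_imp, forall_eq] at hθ
    obtain ⟨hA, hB⟩ := hθ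
    rw [← Ideal.Quotient.eq_zero_iff_mem] at f01 f12 f23 f34 f45 f56 f60 hA hB hθ'
    simp only [map_add, map_mul] at f01 f12 f23 f34 f45 f56 f60 hA hB hθ'
    obtain ⟨h0, h1, h2, h3, h4, h5, h6⟩ :=
      eq_zero_of_seven_cycle f01 f12 f23 f34 f45 f56 f60 hA hB hθ'
    rw [← Ideal.Quotient.eq_zero_iff_mem]
    interval_cases i <;> assumption
  · rw [Ideal.ofList_cons, Ideal.ofList_singleton]
    have q01 := X_mul_X_mem_edgeIdeal (K := K) e01
    have q12 := X_mul_X_mem_edgeIdeal (K := K) e12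
    have q23 := X_mul_X_mem_edgeIdeal (K := K) e23
    have q34 := X_mul_X_mem_edgeIdeal (K := K) e34
    have q45 := X_mul_X_mem_edgeIdeal (K := K) e45
    have q56 := X_mul_X_mem_edgeIdeal (K := K) e56
    have q60 := X_mul_X_mem_edgeIdeal (K := K) e60
    refine Submodule.mem_sup.2
      ⟨X (z 3) * X (z 6) * (X (z 0) + X (z 1) + X (z 2)) +
        X (z 1) * X (z 4) * (X (z 5) + X (z 6) + X (z 2)),
      Ideal.add_mem _
        (Ideal.mem_sup_left (Ideal.mul_mem_left _ _ (Ideal.mem_span_singleton_self _)))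
        (Ideal.mem_sup_right (Ideal.mul_mem_left _ _ (Ideal.mem_span_singleton_self _))),
      X (z 6) * (X (z 1) * X (z 2)) - X (z 3) * (X (z 6) * X (z 0)) -
        X (z 6) * (X (z 2) * X (z 3)) - X (z 1) * (X (z 4) * X (z 5)) -
        X (z 4) * (X (z 1) * X (z 2)),
      Ideal.sub_mem _ (Ideal.sub_mem _ (Ideal.sub_mem _ (Ideal.sub_mem _ (Ideal.mul_mem_left _ _ q12)
        (Ideal.mul_mem_left _ _ q60)) (Ideal.mul_mem_left _ _ q23)) (Ideal.mul_mem_left _ _ q45))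
        (Ideal.mul_mem_left _ _ q12), by ring⟩
  · intro i j hij hj hadj
    have k1 : 2 * ε * -(2 * ε) = 0 := by linear_combination (-4) * hε
    have k2 : (ε - δ) * (ε + δ) = 0 := by linear_combination hε - hδ
    clear_value ε δ
    obtain rfl | ⟨rfl, hj⟩ := hadj
    · have hi : i < 6 := by omega
      interval_cases i
      · simp
      · simpa using k1
      · simp
      · simp
      · simp
      · simpa using k2
    · simp
  · intro i hi
    interval_cases i <;> simp [ε, δ, two_mul]
  · intro ψ hψ
    have g0 := hψ 0 (by norm_num)
    have g1 := hψ 1 (by norm_num)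
    have g2 := hψ 2 (by norm_num)
    have g5 := hψ 5 (by norm_num)
    have g6 := hψ 6 (by norm_num)
    norm_num at g0 g1 g2 g5 g6
    refine ⟨?_, by rw [map_mul, g1, g6]; exact hεδ⟩
    simp only [List.mem_cons, List.not_mem_nil, or_false, forall_eq_or_imp, forall_eq, map_add,
      g0, g1, g2, g5, g6]
    constructor <;> ring

end SimpleGraph

/-! ### Radicals of ideals generated by initial segments of a sequence -/

theorem mem_radical_of_mem_radical_span {R : Type*} [CommRing R] {g : ℕ → R} {n : ℕ} {I : Ideal R}
    {x : R} (hx : x ∈ (Ideal.span (g '' Set.Iio n)).radical) (h : ∀ i < n, g i ∈ I.radical) :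
    x ∈ I.radical := by
  have : Ideal.span (g '' Set.Iio n) ≤ I.radical := by
    rw [Ideal.span_le]
    rintro _ ⟨i, hi, rfl⟩
    exact h i hi
  rw [← Ideal.radical_idem I]
  exact Ideal.radical_mono this hx

theorem mem_radical_span {R : Type*} [CommRing R] {g : ℕ → R} {n i : ℕ} (hi : i < n) :
    g i ∈ (Ideal.span (g '' Set.Iio n)).radical :=
  Ideal.le_radical (Ideal.subset_span ⟨i, hi, rfl⟩)

theorem mul_mem_radical_of_mem_radical {R : Type*} [CommRing R] {I J : Ideal R} {a x : R}
    (hx : x ∈ I.radical) (h : ∀ y ∈ I, a * y ∈ J.radical) : a * x ∈ J.radical := by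
  obtain ⟨n, hn⟩ := hx
  rw [← Ideal.radical_idem J]
  refine ⟨n + 1, ?_⟩
  rw [show (a * x) ^ (n + 1) = a ^ n * x * (a * x ^ n) by ring]
  exact Ideal.mul_mem_left _ _ (h _ hn)

theorem mul_mem_radical_of_mem_radical_span {R : Type*} [CommRing R] {g : ℕ → R} {n : ℕ}
    {J : Ideal R} {a x : R} (hx : x ∈ (Ideal.span (g '' Set.Iio n)).radical)
    (h : ∀ i < n, a * g i ∈ J.radical) : a * x ∈ J.radical := by
  refine mul_mem_radical_of_mem_radical hx fun y hy => ?_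
  have : Ideal.span (g '' Set.Iio n) ≤ Submodule.comap (LinearMap.mulLeft R a) J.radical := by
    rw [Ideal.span_le]
    rintro _ ⟨i, hi, rfl⟩
    exact h i hi
  exact this hy

/-- The Schmitt–Vogel principle: if `p l * h l` vanishes wherever `p 0, …, p (l - 1)` do, then the
common zeros of the sums `p l + h l` are those of all `p l` and `h l`. -/
theorem mem_radical_span_add {R : Type*} [CommRing R] {p h q : ℕ → R} {m : ℕ}
    (hq : ∀ l < m, q l = p l + h l)
    (hprod : ∀ l < m, p l * h l ∈ (Ideal.span (p '' Set.Iio l)).radical) :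
    ∀ n ≤ m, ∀ l < n, p l ∈ (Ideal.span (q '' Set.Iio n)).radical ∧
      h l ∈ (Ideal.span (q '' Set.Iio n)).radical := by
  intro n hn l
  induction l using Nat.strong_induction_on with
  | _ l ih =>
    intro hl
    have hmul : p l * h l ∈ (Ideal.span (q '' Set.Iio n)).radical :=
      mem_radical_of_mem_radical_span (hprod l (hl.trans_le hn)) fun i hi =>
        (ih i hi (hi.trans hl)).1
    have hadd : p l + h l ∈ (Ideal.span (q '' Set.Iio n)).radical := by
      rw [← hq l (hl.trans_le hn)]
      exact mem_radical_span hl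
    have hp : p l ∈ (Ideal.span (q '' Set.Iio n)).radical := by
      rw [← Ideal.radical_idem]
      refine ⟨2, ?_⟩
      rw [show p l ^ 2 = p l * (p l + h l) - p l * h l by ring]
      exact Ideal.sub_mem _ (Ideal.mul_mem_left _ _ hadd) hmul
    exact ⟨hp, by simpa using Ideal.sub_mem _ hadd hp⟩

namespace SimpleGraph

variable {V : Type u} {G : SimpleGraph V}

/-! ### Compatible families of generators up to radical -/

/-- The ideal generated by the edges inside `W` and the vertices in `N`. -/
noncomputable def restrictedIdeal (G : SimpleGraph V) (K : Type v) [Field K] (W N : Finset V) :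
    Ideal (MvPolynomial V K) :=
  Ideal.span {f | ∃ x ∈ W, ∃ y ∈ W, G.Adj x y ∧ f = X x * X y} ⊔ Ideal.span (X '' (N : Set V))

theorem restrictedIdeal_le_iff {K : Type v} [Field K] {W N : Finset V}
    {J : Ideal (MvPolynomial V K)} : G.restrictedIdeal K W N ≤ J ↔
      (∀ x ∈ W, ∀ y ∈ W, G.Adj x y → X x * X y ∈ J) ∧ ∀ v ∈ N, X v ∈ J := by
  rw [restrictedIdeal, sup_le_iff, Ideal.span_le, Ideal.span_le]
  constructor
  · exact fun ⟨h1, h2⟩ => ⟨fun x hx y hy hxy => h1 ⟨x, hx, y, hy, hxy, rfl⟩,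
      fun v hv => h2 ⟨v, hv, rfl⟩⟩
  · rintro ⟨h1, h2⟩
    refine ⟨?_, ?_⟩
    · rintro _ ⟨x, hx, y, hy, hxy, rfl⟩
      exact h1 x hx y hy hxy
    · rintro _ ⟨v, hv, rfl⟩
      exact h2 v hv

theorem X_mul_X_mem_restrictedIdeal {K : Type v} [Field K] {W N : Finset V} {x y : V}
    (hx : x ∈ W) (hy : y ∈ W) (h : G.Adj x y) : X x * X y ∈ G.restrictedIdeal K W N :=
  Ideal.mem_sup_left (Ideal.subset_span ⟨x, hx, y, hy, h, rfl⟩)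

theorem X_mem_restrictedIdeal {K : Type v} [Field K] {W N : Finset V} {x : V}
    (hx : x ∈ N) : X x ∈ G.restrictedIdeal K W N :=
  Ideal.mem_sup_right (Ideal.subset_span ⟨x, hx, rfl⟩)

theorem restrictedIdeal_mono {K : Type v} [Field K] {W W' N N' : Finset V} (hW : W ⊆ W')
    (hN : N ⊆ N') : G.restrictedIdeal K W N ≤ G.restrictedIdeal K W' N' :=
  restrictedIdeal_le_iff.2 ⟨fun _ hx _ hy h => X_mul_X_mem_restrictedIdeal (hW hx) (hW hy) h,
    fun _ hv => X_mem_restrictedIdeal (hN hv)⟩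

/-- A set `N ⊆ W` of vertices that may be deleted from `W`: each of its elements has a neighbour
outside `W`, and `W \ N` is well-covered with independence number `k` (in applications, the
independence number of `W` itself). -/
structure Removable [DecidableEq V] (G : SimpleGraph V) (W : Finset V) (k : ℕ) (N : Finset V) :
    Prop where
  subset : N ⊆ W
  exists_adj : ∀ v ∈ N, ∃ u ∉ W, G.Adj u v
  wellCoveredOn : G.WellCoveredOn (W \ N) k

/-- For every removable `N`, the polynomials `f N 0, …, f N (m - 1)` generate the ideal
`restrictedIdeal W N` up to radical, and enlarging `N` enlarges, up to radical, the ideal generated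
by each initial segment. The second condition makes it possible to merge the sequences belonging
to several `N` into a single one. -/
structure IsGeneratingFamily [DecidableEq V] (G : SimpleGraph V) (K : Type v) [Field K]
    (W : Finset V) (k m : ℕ) (f : Finset V → ℕ → MvPolynomial V K) : Prop where
  radical_eq : ∀ N, G.Removable W k N →
    (Ideal.span (f N '' Set.Iio m)).radical = (G.restrictedIdeal K W N).radical
  mem_radical : ∀ N N', G.Removable W k N → G.Removable W k N' → N ⊆ N' → ∀ j < m,
    f N j ∈ (Ideal.span (f N' '' Set.Iio (j + 1))).radical

/-- `W` has a generating family with as many members as the height `|W| - k` of the edge ideal of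
the induced subgraph, if that is well-covered with independence number `k`. -/
def HasGeneratingFamily [DecidableEq V] (G : SimpleGraph V) (K : Type v) [Field K]
    (W : Finset V) : Prop :=
  ∀ k, G.WellCoveredOn W k → ∃ m f, m + k = W.card ∧ G.IsGeneratingFamily K W k m f

/-- Well-coveredness passes to links: a maximal independent set of the link of `F` becomes one of
`U` on adding `F`. -/
theorem WellCoveredOn.link [DecidableEq V] {U U' F : Finset V} {k : ℕ} (h : G.WellCoveredOn U k)
    (hFU : F ⊆ U) (hF : G.IsIndepSet (F : Set V))
    (hU' : ∀ v, v ∈ U' ↔ v ∈ U ∧ v ∉ F ∧ ∀ f ∈ F, ¬ G.Adj f v) :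
    G.WellCoveredOn U' (k - F.card) := by
  intro S hS
  rw [isMaxIndepIn_iff] at hS
  obtain ⟨h1, h2, h3⟩ := hS
  have hdisj : Disjoint S F := Finset.disjoint_left.2 fun v hv => ((hU' v).1 (h1 hv)).2.1
  have hmax : G.IsMaxIndepIn U (S ∪ F) := by
    rw [isMaxIndepIn_iff]
    refine ⟨Finset.union_subset (fun v hv => ((hU' v).1 (h1 hv)).1) hFU, ?_, ?_⟩
    · rintro x hx y hy hne hadj
      simp only [Finset.coe_union, Set.mem_union, Finset.mem_coe] at hx hy
      rcases hx with hx | hx <;> rcases hy with hy | hy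
      · exact h2 hx hy hne hadj
      · exact ((hU' x).1 (h1 hx)).2.2 y hy hadj.symm
      · exact ((hU' y).1 (h1 hy)).2.2 x hx hadj
      · exact hF hx hy hne hadj
    · intro w hw hwSF
      rw [Finset.mem_union, not_or] at hwSF
      by_cases hwU' : w ∈ U'
      · obtain ⟨s, hs, hadj⟩ := h3 w hwU' hwSF.1
        exact ⟨s, Finset.mem_union_left _ hs, hadj⟩
      · rw [hU'] at hwU'
        push Not at hwU'
        obtain ⟨f, hf, hadj⟩ := hwU' hw hwSF.2
        exact ⟨f, Finset.mem_union_right _ hf, hadj⟩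
  have := h _ hmax
  rw [Finset.card_union_of_disjoint hdisj] at this
  omega

theorem WellCoveredOn.link_singleton [DecidableEq V] {U U' : Finset V} {c : V} {k : ℕ}
    (h : G.WellCoveredOn U k) (hc : c ∈ U) (hU' : ∀ v, v ∈ U' ↔ v ∈ U ∧ v ≠ c ∧ ¬ G.Adj c v) :
    G.WellCoveredOn U' (k - 1) :=
  h.link (F := {c}) (by simpa using hc) (by simp) (by simpa using hU')

theorem WellCoveredOn.pos {U : Finset V} {c : V} {k : ℕ} (h : G.WellCoveredOn U k) (hc : c ∈ U) :
    0 < k := by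
  have := h.card_le (T := {c}) (by simpa using hc) (by simp)
  rwa [Finset.card_singleton] at this

theorem isIndepSet_insert {S : Finset V} [DecidableEq V] {c : V} (hS : G.IsIndepSet (S : Set V))
    (hc : ∀ s ∈ S, ¬ G.Adj c s) : G.IsIndepSet ((insert c S : Finset V) : Set V) := by
  rw [Finset.coe_insert]
  exact Set.Pairwise.insert hS fun s hs _ => ⟨hc s hs, fun h => hc s hs h.symm⟩

/-! ### Removing isolated vertices and pendant edges -/

theorem hasGeneratingFamily_of_forall_not_adj [DecidableEq V] {K : Type v} [Field K] {W : Finset V}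
    (hW : ∀ x ∈ W, ∀ y ∈ W, ¬ G.Adj x y) : G.HasGeneratingFamily K W := by
  intro k hk
  have hindep : ∀ N ⊆ W, G.IsMaxIndepIn N N := fun N hN => by
    rw [isMaxIndepIn_iff]
    exact ⟨subset_rfl, fun x hx y hy _ => hW x (hN hx) y (hN hy), fun w hw h => absurd hw h⟩
  have hk' := hk W (hindep W subset_rfl)
  refine ⟨0, fun _ _ => 0, by omega, fun N hN => ?_, fun _ _ _ _ _ j hj => absurd hj (by omega)⟩
  have h1 := hN.wellCoveredOn _ (hindep _ Finset.sdiff_subset)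
  have h2 := Finset.card_sdiff_add_card_eq_card hN.subset
  have h3 : N = ∅ := Finset.card_eq_zero.1 (by omega)
  congr 1
  rw [eq_comm, eq_bot_iff.2 (restrictedIdeal_le_iff.2 ⟨fun x hx y hy h => absurd h (hW x hx y hy),
    fun v hv => by simp [h3] at hv⟩)]
  simp

/-- An isolated vertex lies in every maximal independent set, so it is never deleted, and the
families of `W.erase c` serve for `W` as well. -/
theorem HasGeneratingFamily.of_isolated [DecidableEq V] {K : Type v} [Field K] {W : Finset V}
    {c : V} (hc : c ∈ W) (hiso : ∀ v ∈ W, ¬ G.Adj c v) (h : G.HasGeneratingFamily K (W.erase c)) :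
    G.HasGeneratingFamily K W := by
  intro k hk
  have hkpos := hk.pos hc
  have hcard := Finset.card_erase_add_one hc
  obtain ⟨m, f, hm, hf⟩ := h (k - 1) (hk.link_singleton hc fun v => by grind)
  have hrem : ∀ N, G.Removable W k N → G.Removable (W.erase c) (k - 1) N := by
    intro N hN
    have hcN : c ∉ N := by
      intro hcN
      obtain ⟨S, -, hS⟩ := exists_isMaxIndepIn (G := G) (W := W \ N) (T := ∅) (by simp) (by simp)
      have h1 := hN.wellCoveredOn S hS
      have hS' := (isMaxIndepIn_iff.1 hS)
      have hcS : c ∉ S := fun h => (Finset.mem_sdiff.1 (hS'.1 h)).2 hcN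
      have h2 := hk.card_le (T := insert c S)
        (Finset.insert_subset hc (hS'.1.trans Finset.sdiff_subset))
        (isIndepSet_insert hS'.2.1 fun s hs => hiso s (Finset.sdiff_subset (hS'.1 hs)))
      rw [Finset.card_insert_of_notMem hcS] at h2
      omega
    refine ⟨fun v hv => Finset.mem_erase.2 ⟨fun h => hcN (h ▸ hv), hN.subset hv⟩, fun v hv => ?_, ?_⟩
    · obtain ⟨u, hu, hadj⟩ := hN.exists_adj v hv
      exact ⟨u, fun h => hu (Finset.mem_of_mem_erase h), hadj⟩
    · exact hN.wellCoveredOn.link_singleton (Finset.mem_sdiff.2 ⟨hc, hcN⟩) fun v => by grind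
  refine ⟨m, f, by omega, fun N hN => ?_, fun N N' hN hN' => hf.mem_radical N N' (hrem N hN)
    (hrem N' hN')⟩
  rw [hf.radical_eq N (hrem N hN)]
  congr 1
  refine le_antisymm (restrictedIdeal_mono (Finset.erase_subset _ _) subset_rfl)
    (restrictedIdeal_le_iff.2 ⟨fun x hx y hy hxy => ?_, fun v hv => X_mem_restrictedIdeal hv⟩)
  refine X_mul_X_mem_restrictedIdeal (Finset.mem_erase.2 ⟨?_, hx⟩) (Finset.mem_erase.2 ⟨?_, hy⟩) hxy
  · rintro rfl; exact hiso y hy hxy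
  · rintro rfl; exact hiso x hx hxy.symm

/-- The set `W` contains the pendant edge `{a, b}`, whose endpoint `b` has no other neighbour
in `W`. -/
structure IsPendantIn (G : SimpleGraph V) (W : Finset V) (a b : V) : Prop where
  left_mem : a ∈ W
  right_mem : b ∈ W
  adj : G.Adj a b
  eq_of_adj : ∀ v ∈ W, G.Adj b v → v = a

section Pendant

variable [DecidableEq V] {W N : Finset V} {a b : V} {k : ℕ}

theorem IsPendantIn.mem_erase_iff (h : G.IsPendantIn W a b) {v : V} :
    v ∈ (W.erase a).erase b ↔ v ∈ W ∧ v ≠ b ∧ ¬ G.Adj b v := by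
  have h1 := h.adj.symm
  have h2 := h.eq_of_adj
  grind

/-- If `b` is deleted, then `a` is isolated in what remains: otherwise `W \ N` has a maximal
independent set without `a`, to which `b` can be added in `W`. -/
theorem IsPendantIn.of_right_mem (h : G.IsPendantIn W a b) (hk : G.WellCoveredOn W k)
    (hN : G.Removable W k N) (hb : b ∈ N) : a ∉ N ∧ ∀ v ∈ W, G.Adj a v → v ∈ N := by
  have key : ∀ S, G.IsMaxIndepIn (W \ N) S → a ∈ S := by
    intro S hS
    by_contra haS
    have h1 := hN.wellCoveredOn S hS
    have hS' := (isMaxIndepIn_iff.1 hS)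
    have hbS : b ∉ S := fun h => (Finset.mem_sdiff.1 (hS'.1 h)).2 hb
    have h2 := hk.card_le (T := insert b S)
      (Finset.insert_subset h.right_mem (hS'.1.trans Finset.sdiff_subset))
      (isIndepSet_insert hS'.2.1 fun s hs hadj =>
        haS (h.eq_of_adj s (Finset.sdiff_subset (hS'.1 hs)) hadj ▸ hs))
    rw [Finset.card_insert_of_notMem hbS] at h2
    omega
  obtain ⟨S, -, hS⟩ := exists_isMaxIndepIn (G := G) (W := W \ N) (T := ∅) (by simp) (by simp)
  refine ⟨(Finset.mem_sdiff.1 ((isMaxIndepIn_iff.1 hS).1 (key S hS))).2, fun v hv hav => ?_⟩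
  by_contra hvN
  obtain ⟨S, hvS, hS⟩ := exists_isMaxIndepIn (G := G) (W := W \ N) (T := {v})
    (by simpa using ⟨hv, hvN⟩) (by simp)
  exact hS.1.2 (key S hS) (hvS (by simp)) hav.ne hav

theorem IsPendantIn.removable_erase_left (h : G.IsPendantIn W a b) (hk : G.WellCoveredOn W k)
    (hN : G.Removable W k N) (ha : a ∈ N) :
    G.Removable ((W.erase a).erase b) (k - 1) (N.erase a) := by
  have hb : b ∉ N := fun hb => (h.of_right_mem hk hN hb).1 ha
  have hsub := hN.subset
  refine ⟨by grind, fun v hv => ?_, hN.wellCoveredOn.link_singleton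
    (Finset.mem_sdiff.2 ⟨h.right_mem, hb⟩) fun v => ?_⟩
  · obtain ⟨u, hu, hadj⟩ := hN.exists_adj v (Finset.mem_of_mem_erase hv)
    exact ⟨u, by grind, hadj⟩
  · have := h.mem_erase_iff (v := v)
    grind

theorem IsPendantIn.removable_erase_right (h : G.IsPendantIn W a b) (hk : G.WellCoveredOn W k)
    (hN : G.Removable W k N) (hb : b ∈ N) :
    G.Removable ((W.erase a).erase b) (k - 1) (N.erase b) := by
  obtain ⟨ha, hnb⟩ := h.of_right_mem hk hN hb
  have hsub := hN.subset
  refine ⟨by grind, fun v hv => ?_, hN.wellCoveredOn.link_singleton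
    (Finset.mem_sdiff.2 ⟨h.left_mem, ha⟩) fun v => ?_⟩
  · obtain ⟨u, hu, hadj⟩ := hN.exists_adj v (Finset.mem_of_mem_erase hv)
    exact ⟨u, by grind, hadj⟩
  · have := h.adj
    have := hnb v
    grind

theorem IsPendantIn.removable_of_notMem (h : G.IsPendantIn W a b)
    (hN : G.Removable W k N) (ha : a ∉ N) (hb : b ∉ N) :
    G.Removable ((W.erase a).erase b) (k - 1) N := by
  have hsub := hN.subset
  refine ⟨by grind, fun v hv => ?_, hN.wellCoveredOn.link_singleton
    (Finset.mem_sdiff.2 ⟨h.right_mem, hb⟩) fun v => ?_⟩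
  · obtain ⟨u, hu, hadj⟩ := hN.exists_adj v hv
    exact ⟨u, by grind, hadj⟩
  · have := h.mem_erase_iff (v := v)
    grind

open Classical in
/-- Where `a` is invertible, all neighbours of `a` vanish, which amounts to deleting them. -/
theorem IsPendantIn.removable_union (h : G.IsPendantIn W a b)
    (hN : G.Removable W k N) (ha : a ∉ N) (hb : b ∉ N) :
    G.Removable ((W.erase a).erase b) (k - 1)
      (N ∪ ((W.erase a).erase b).filter (G.Adj a)) := by
  have hsub := hN.subset
  refine ⟨by grind, fun v hv => ?_, hN.wellCoveredOn.link_singleton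
    (Finset.mem_sdiff.2 ⟨h.left_mem, ha⟩) fun v => ?_⟩
  · rcases Finset.mem_union.1 hv with hv | hv
    · obtain ⟨u, hu, hadj⟩ := hN.exists_adj v hv
      exact ⟨u, by grind, hadj⟩
    · exact ⟨a, by simp, (Finset.mem_filter.1 hv).2⟩
  · have := h.adj
    grind

open Classical in
/-- The generating family of `W` obtained from a generating family `f` of `W \ {a, b}` with `m`
members, where `{a, b}` is a pendant edge. If neither `a` nor `b` is deleted, then the family is
merged from one on the locus where `a` is invertible, that of `N ∪ N(a)` followed by `b`, and one on
the locus where `a` vanishes, that of `N`. -/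
noncomputable def pendantFamily {K : Type v} [Field K] (G : SimpleGraph V) (W : Finset V) (a b : V)
    (m : ℕ) (f : Finset V → ℕ → MvPolynomial V K) (N : Finset V) (j : ℕ) : MvPolynomial V K :=
  if a ∈ N then (if j = 0 then X a else f (N.erase a) (j - 1))
  else if b ∈ N then (if j < m then f (N.erase b) j else X b)
  else X a * (if j < m then f (N ∪ ((W.erase a).erase b).filter (G.Adj a)) j else X b) +
    (if j = 0 then 0 else f N (j - 1))

variable {K : Type v} [Field K] {m : ℕ} {f : Finset V → ℕ → MvPolynomial V K}

open Classical in
/-- The two summands of a member of `pendantFamily` lie in the radical that the members generate, by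
the Schmitt–Vogel principle. Its hypothesis is the compatibility of the families of `N` and `N ∪
N(a)`. -/
theorem IsPendantIn.mem_radical_pendantFamily (h : G.IsPendantIn W a b)
    (hf : G.IsGeneratingFamily K ((W.erase a).erase b) (k - 1) m f)
    (hN : G.Removable W k N) (ha : a ∉ N) (hb : b ∉ N) {n l : ℕ} (hn : n ≤ m + 1) (hl : l < n) :
    X a * (if l < m then f (N ∪ ((W.erase a).erase b).filter (G.Adj a)) l else X b) ∈
      (Ideal.span (pendantFamily G W a b m f N '' Set.Iio n)).radical ∧
    (if l = 0 then 0 else f N (l - 1)) ∈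
      (Ideal.span (pendantFamily G W a b m f N '' Set.Iio n)).radical := by
  refine mem_radical_span_add (m := m + 1)
    (p := fun l => X a * (if l < m then f (N ∪ ((W.erase a).erase b).filter (G.Adj a)) l else X b))
    (h := fun l => if l = 0 then 0 else f N (l - 1)) ?_ ?_ n hn l hl
  · intro l _
    simp only [pendantFamily, if_neg ha, if_neg hb]
  · intro l hl
    split_ifs with h1 h2 h2
    · rw [mul_zero]; exact Ideal.zero_mem _
    all_goals first | (rw [mul_zero]; exact Ideal.zero_mem _) | skip
    all_goals
      rw [mul_right_comm]
      refine Ideal.mul_mem_right _ _ ?_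
      have hmem := hf.mem_radical N _ (h.removable_of_notMem hN ha hb) (h.removable_union hN ha hb)
        Finset.subset_union_left (l - 1) (by omega)
      rw [Nat.sub_add_cancel (by omega)] at hmem
      refine mul_mem_radical_of_mem_radical_span hmem fun i hi => ?_
      refine Ideal.le_radical (Ideal.subset_span ⟨i, hi, ?_⟩)
      dsimp only
      rw [if_pos (by omega)]

open Classical in
theorem IsPendantIn.radical_pendantFamily (h : G.IsPendantIn W a b) (hk : G.WellCoveredOn W k)
    (hf : G.IsGeneratingFamily K ((W.erase a).erase b) (k - 1) m f) (hN : G.Removable W k N) :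
    (Ideal.span (pendantFamily G W a b m f N '' Set.Iio (m + 1))).radical =
      (G.restrictedIdeal K W N).radical := by
  have hsub : (W.erase a).erase b ⊆ W :=
    (Finset.erase_subset _ _).trans (Finset.erase_subset _ _)
  have hf' : ∀ N', G.Removable ((W.erase a).erase b) (k - 1) N' → ∀ i < m,
      f N' i ∈ (G.restrictedIdeal K ((W.erase a).erase b) N').radical := fun N' hN' i hi => by
    rw [← hf.radical_eq N' hN']
    exact mem_radical_span hi
  -- every edge in `W` is an edge in `W \ {a, b}` or contains `a`
  have hedge : ∀ J : Ideal (MvPolynomial V K),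
      (∀ x ∈ (W.erase a).erase b, ∀ y ∈ (W.erase a).erase b, G.Adj x y → X x * X y ∈ J) →
      (∀ y ∈ W, G.Adj a y → X a * X y ∈ J) → ∀ x ∈ W, ∀ y ∈ W, G.Adj x y → X x * X y ∈ J := by
    intro J h1 h2 x hx y hy hxy
    by_cases hxa : x = a
    · exact hxa ▸ h2 y hy (hxa ▸ hxy)
    by_cases hya : y = a
    · rw [mul_comm]; exact hya ▸ h2 x hx (hya ▸ hxy.symm)
    refine h1 x ?_ y ?_ hxy
    · exact Finset.mem_erase.2
        ⟨fun hxb => hya (h.eq_of_adj y hy (hxb ▸ hxy)), Finset.mem_erase.2 ⟨hxa, hx⟩⟩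
    · exact Finset.mem_erase.2
        ⟨fun hyb => hxa (h.eq_of_adj x hx (hyb ▸ hxy.symm)), Finset.mem_erase.2 ⟨hya, hy⟩⟩
  -- it suffices to compare generators
  suffices hs : (∀ i < m + 1, pendantFamily G W a b m f N i ∈ (G.restrictedIdeal K W N).radical) ∧
      G.restrictedIdeal K W N ≤
        (Ideal.span (pendantFamily G W a b m f N '' Set.Iio (m + 1))).radical by
    refine le_antisymm ?_ ?_
    · rw [← Ideal.radical_idem (G.restrictedIdeal K W N)]
      refine Ideal.radical_mono (Ideal.span_le.2 ?_)
      rintro _ ⟨i, hi, rfl⟩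
      exact hs.1 i hi
    · rw [← Ideal.radical_idem (Ideal.span _)]
      exact Ideal.radical_mono hs.2
  by_cases ha : a ∈ N
  · have hN1 := h.removable_erase_left hk hN ha
    have hfam0 : pendantFamily G W a b m f N 0 = X a := by simp [pendantFamily, ha]
    have hfam : ∀ i, pendantFamily G W a b m f N (i + 1) = f (N.erase a) i := fun i => by
      simp [pendantFamily, ha]
    have hle : G.restrictedIdeal K ((W.erase a).erase b) (N.erase a) ≤
        (Ideal.span (pendantFamily G W a b m f N '' Set.Iio (m + 1))).radical := by
      intro x hx
      refine mem_radical_of_mem_radical_span (g := f (N.erase a)) (n := m) ?_ fun i hi => ?_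
      · rw [hf.radical_eq _ hN1]; exact Ideal.le_radical hx
      · rw [← hfam]; exact mem_radical_span (by omega)
    have hXa : X a ∈ (Ideal.span (pendantFamily G W a b m f N '' Set.Iio (m + 1))).radical := by
      rw [← hfam0]; exact mem_radical_span (by omega)
    refine ⟨fun i hi => ?_, restrictedIdeal_le_iff.2 ⟨hedge _ (fun x hx y hy hxy =>
      hle (X_mul_X_mem_restrictedIdeal hx hy hxy)) (fun y _ _ => Ideal.mul_mem_right _ _ hXa), ?_⟩⟩
    · cases i with
      | zero => rw [hfam0]; exact Ideal.le_radical (X_mem_restrictedIdeal ha)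
      | succ i =>
        rw [hfam]
        exact Ideal.radical_mono (restrictedIdeal_mono hsub (Finset.erase_subset _ _))
          (hf' _ hN1 i (by omega))
    · intro v hv
      by_cases hva : v = a
      · exact hva ▸ hXa
      · exact hle (X_mem_restrictedIdeal (Finset.mem_erase.2 ⟨hva, hv⟩))
  by_cases hb : b ∈ N
  · have hN1 := h.removable_erase_right hk hN hb
    have hfam0 : pendantFamily G W a b m f N m = X b := by simp [pendantFamily, ha, hb]
    have hfam : ∀ i < m, pendantFamily G W a b m f N i = f (N.erase b) i := fun i hi => by
      simp [pendantFamily, ha, hb, hi]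
    have hle : G.restrictedIdeal K ((W.erase a).erase b) (N.erase b) ≤
        (Ideal.span (pendantFamily G W a b m f N '' Set.Iio (m + 1))).radical := by
      intro x hx
      refine mem_radical_of_mem_radical_span (g := f (N.erase b)) (n := m) ?_ fun i hi => ?_
      · rw [hf.radical_eq _ hN1]; exact Ideal.le_radical hx
      · rw [← hfam i hi]; exact mem_radical_span (by omega)
    have hNle : ∀ v ∈ N,
        X v ∈ (Ideal.span (pendantFamily G W a b m f N '' Set.Iio (m + 1))).radical := by
      intro v hv
      by_cases hvb : v = b
      · rw [hvb, ← hfam0]; exact mem_radical_span (by omega)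
      · exact hle (X_mem_restrictedIdeal (Finset.mem_erase.2 ⟨hvb, hv⟩))
    refine ⟨fun i hi => ?_, restrictedIdeal_le_iff.2 ⟨hedge _ (fun x hx y hy hxy =>
      hle (X_mul_X_mem_restrictedIdeal hx hy hxy)) (fun y hy hay => Ideal.mul_mem_left _ _
        (hNle y ((h.of_right_mem hk hN hb).2 y hy hay))), hNle⟩⟩
    by_cases hi' : i < m
    · rw [hfam i hi']
      exact Ideal.radical_mono (restrictedIdeal_mono hsub (Finset.erase_subset _ _))
        (hf' _ hN1 i hi')
    · rw [show i = m by omega, hfam0]; exact Ideal.le_radical (X_mem_restrictedIdeal hb)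
  · have hN1 := h.removable_of_notMem hN ha hb
    have hN2 := h.removable_union hN ha hb
    have hfam := fun l (hl : l < m + 1) => h.mem_radical_pendantFamily hf hN ha hb le_rfl hl
    have hle : G.restrictedIdeal K ((W.erase a).erase b) N ≤
        (Ideal.span (pendantFamily G W a b m f N '' Set.Iio (m + 1))).radical := by
      intro x hx
      refine mem_radical_of_mem_radical_span (g := f N) (n := m) ?_ fun i hi => ?_
      · rw [hf.radical_eq _ hN1]; exact Ideal.le_radical hx
      · simpa using (hfam (i + 1) (by omega)).2
    refine ⟨fun i hi => ?_, restrictedIdeal_le_iff.2 ⟨hedge _ (fun x hx y hy hxy =>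
      hle (X_mul_X_mem_restrictedIdeal hx hy hxy)) (fun y hy hay => ?_),
      fun v hv => hle (X_mem_restrictedIdeal hv)⟩⟩
    · simp only [pendantFamily, if_neg ha, if_neg hb]
      refine Ideal.add_mem _ ?_ ?_
      · split_ifs with hi'
        · refine mul_mem_radical_of_mem_radical (hf' _ hN2 i hi') fun y hy => ?_
          have : G.restrictedIdeal K ((W.erase a).erase b)
              (N ∪ ((W.erase a).erase b).filter (G.Adj a)) ≤
              Submodule.comap (LinearMap.mulLeft _ (X a)) (G.restrictedIdeal K W N) := by
            refine restrictedIdeal_le_iff.2 ⟨fun x hx y hy hxy => ?_, fun v hv => ?_⟩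
            · change (X a * (X x * X y) : MvPolynomial V K) ∈ G.restrictedIdeal K W N
              exact Ideal.mul_mem_left _ _
                (X_mul_X_mem_restrictedIdeal (hsub hx) (hsub hy) hxy)
            change (X a * X v : MvPolynomial V K) ∈ G.restrictedIdeal K W N
            rcases Finset.mem_union.1 hv with hv | hv
            · exact Ideal.mul_mem_left _ _ (X_mem_restrictedIdeal hv)
            · exact X_mul_X_mem_restrictedIdeal h.left_mem (hsub (Finset.mem_filter.1 hv).1)
                (Finset.mem_filter.1 hv).2
          exact Ideal.le_radical (this hy)
        · exact Ideal.le_radical (X_mul_X_mem_restrictedIdeal h.left_mem h.right_mem h.adj)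
      · split_ifs with hi'
        · exact Ideal.zero_mem _
        · exact Ideal.radical_mono (restrictedIdeal_mono hsub subset_rfl)
            (hf' _ hN1 (i - 1) (by omega))
    · by_cases hyb : y = b
      · rw [hyb]
        simpa using (hfam m (by omega)).1
      · have hy2 : y ∈ N ∪ ((W.erase a).erase b).filter (G.Adj a) :=
          Finset.mem_union_right _ (Finset.mem_filter.2
            ⟨Finset.mem_erase.2 ⟨hyb, Finset.mem_erase.2 ⟨hay.ne', hy⟩⟩, hay⟩)
        have hy3 : X y ∈ (Ideal.span
            (f (N ∪ ((W.erase a).erase b).filter (G.Adj a)) '' Set.Iio m)).radical := by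
          rw [hf.radical_eq _ hN2]; exact Ideal.le_radical (X_mem_restrictedIdeal hy2)
        refine mul_mem_radical_of_mem_radical_span hy3 fun i hi => ?_
        simpa [hi] using (hfam i (by omega)).1

open Classical in
theorem IsPendantIn.pendantFamily_mem_radical (h : G.IsPendantIn W a b)
    (hk : G.WellCoveredOn W k)
    (hf : G.IsGeneratingFamily K ((W.erase a).erase b) (k - 1) m f) {N' : Finset V}
    (hN : G.Removable W k N) (hN' : G.Removable W k N') (hNN' : N ⊆ N') {j : ℕ}
    (hj : j < m + 1) :
    pendantFamily G W a b m f N j ∈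
      (Ideal.span (pendantFamily G W a b m f N' '' Set.Iio (j + 1))).radical := by
  by_cases ha' : a ∈ N'
  · have hN1' := h.removable_erase_left hk hN' ha'
    have hb' : b ∉ N' := fun hb => (h.of_right_mem hk hN' hb).1 ha'
    have hb : b ∉ N := fun hb => hb' (hNN' hb)
    have hfam0 : pendantFamily G W a b m f N' 0 = X a := by simp [pendantFamily, ha']
    have hfam : ∀ i, pendantFamily G W a b m f N' (i + 1) = f (N'.erase a) i := fun i => by
      simp [pendantFamily, ha']
    have hXa : X a ∈ (Ideal.span (pendantFamily G W a b m f N' '' Set.Iio (j + 1))).radical := by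
      rw [← hfam0]; exact mem_radical_span (by omega)
    have hstep : ∀ N₁, G.Removable ((W.erase a).erase b) (k - 1) N₁ → N₁ ⊆ N'.erase a → j ≠ 0 →
        f N₁ (j - 1) ∈
          (Ideal.span (pendantFamily G W a b m f N' '' Set.Iio (j + 1))).radical := by
      intro N₁ hN₁ hsub hj0
      have := hf.mem_radical N₁ _ hN₁ hN1' hsub (j - 1) (by omega)
      rw [Nat.sub_add_cancel (by omega)] at this
      refine mem_radical_of_mem_radical_span this fun i hi => ?_
      rw [← hfam]; exact mem_radical_span (by omega)
    by_cases ha : a ∈ N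
    · simp only [pendantFamily.eq_def (N := N), if_pos ha]
      split_ifs with hj0
      · exact hXa
      · exact hstep _ (h.removable_erase_left hk hN ha) (Finset.erase_subset_erase _ hNN') hj0
    · simp only [pendantFamily.eq_def (N := N), if_neg ha, if_neg hb]
      refine Ideal.add_mem _ (Ideal.mul_mem_right _ _ hXa) ?_
      split_ifs with hj0
      · exact Ideal.zero_mem _
      · exact hstep _ (h.removable_of_notMem hN ha hb) (fun v hv => Finset.mem_erase.2
          ⟨fun hva => ha (hva ▸ hv), hNN' hv⟩) hj0
  have ha : a ∉ N := fun ha => ha' (hNN' ha)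
  by_cases hb' : b ∈ N'
  · have hN1' := h.removable_erase_right hk hN' hb'
    have hfam0 : pendantFamily G W a b m f N' m = X b := by simp [pendantFamily, ha', hb']
    have hfam : ∀ i < m, pendantFamily G W a b m f N' i = f (N'.erase b) i := fun i hi => by
      simp [pendantFamily, ha', hb', hi]
    have hstep : ∀ N₁, G.Removable ((W.erase a).erase b) (k - 1) N₁ → N₁ ⊆ N'.erase b →
        ∀ i < m, i ≤ j → f N₁ i ∈
          (Ideal.span (pendantFamily G W a b m f N' '' Set.Iio (j + 1))).radical := by
      intro N₁ hN₁ hsub i hi hij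
      refine mem_radical_of_mem_radical_span (hf.mem_radical N₁ _ hN₁ hN1' hsub i hi)
        fun l hl => ?_
      rw [← hfam l (by omega)]; exact mem_radical_span (by omega)
    have hXb : ¬ j < m →
        X b ∈ (Ideal.span (pendantFamily G W a b m f N' '' Set.Iio (j + 1))).radical := by
      intro hjm
      rw [← hfam0]; exact mem_radical_span (by omega)
    by_cases hb : b ∈ N
    · simp only [pendantFamily.eq_def (N := N), if_neg ha, if_pos hb]
      split_ifs with hjm
      · exact hstep _ (h.removable_erase_right hk hN hb) (Finset.erase_subset_erase _ hNN') j hjm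
          le_rfl
      · exact hXb hjm
    · have hsub : N ⊆ N'.erase b := fun v hv => Finset.mem_erase.2
          ⟨fun hvb => hb (hvb ▸ hv), hNN' hv⟩
      simp only [pendantFamily.eq_def (N := N), if_neg ha, if_neg hb]
      refine Ideal.add_mem _ (Ideal.mul_mem_left _ _ ?_) ?_
      · split_ifs with hjm
        · refine hstep _ (h.removable_union hN ha hb) (Finset.union_subset hsub fun v hv => ?_) j hjm
            le_rfl
          have hv1 := (Finset.mem_filter.1 hv).1
          have hv2 := (Finset.mem_filter.1 hv).2
          exact Finset.mem_erase.2 ⟨(Finset.mem_erase.1 hv1).1, (h.of_right_mem hk hN' hb').2 v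
            (Finset.mem_of_mem_erase (Finset.mem_of_mem_erase hv1)) hv2⟩
        · exact hXb hjm
      · split_ifs with hj0
        · exact Ideal.zero_mem _
        · exact hstep _ (h.removable_of_notMem hN ha hb) hsub (j - 1) (by omega) (by omega)
  · have hb : b ∉ N := fun hb => hb' (hNN' hb)
    have hfam := fun l (hl : l < j + 1) =>
      h.mem_radical_pendantFamily hf hN' ha' hb' (show j + 1 ≤ m + 1 by omega) hl
    simp only [pendantFamily.eq_def (N := N), if_neg ha, if_neg hb]
    refine Ideal.add_mem _ ?_ ?_
    · split_ifs with hjm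
      · refine mul_mem_radical_of_mem_radical_span (hf.mem_radical _ _ (h.removable_union hN ha hb)
          (h.removable_union hN' ha' hb') (Finset.union_subset_union_left hNN') j hjm) fun i hi => ?_
        have := (hfam i hi).1
        rwa [if_pos (by omega)] at this
      · have := (hfam j (by omega)).1
        rwa [if_neg hjm] at this
    · split_ifs with hj0
      · exact Ideal.zero_mem _
      · have := hf.mem_radical N N' (h.removable_of_notMem hN ha hb)
          (h.removable_of_notMem hN' ha' hb') hNN' (j - 1) (by omega)
        rw [Nat.sub_add_cancel (by omega)] at this
        refine mem_radical_of_mem_radical_span this fun i hi => ?_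
        simpa using (hfam (i + 1) (by omega)).2

/-- In a well-covered `W`, the removal of a pendant edge lowers the independence number by one and
hence the height by one. -/
theorem HasGeneratingFamily.of_isPendantIn (h : G.IsPendantIn W a b)
    (hW : G.HasGeneratingFamily K ((W.erase a).erase b)) : G.HasGeneratingFamily K W := by
  intro k hk
  have hkpos := hk.pos h.left_mem
  have h1 := Finset.card_erase_add_one h.left_mem
  have h2 := Finset.card_erase_add_one (Finset.mem_erase.2 ⟨h.adj.ne', h.right_mem⟩)
  obtain ⟨m, f, hm, hf⟩ := hW (k - 1) (hk.link_singleton h.right_mem fun v => h.mem_erase_iff)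
  exact ⟨m + 1, pendantFamily G W a b m f, by omega, fun N hN => h.radical_pendantFamily hk hf hN,
    fun N N' hN hN' hNN' j hj => h.pendantFamily_mem_radical hk hf hN hN' hNN' hj⟩

end Pendant

/-! ### Cycles of length three and five -/

/-- With `p` and `q` both equal to the third vertex of a triangle with vertices `a` and `b`, two
polynomials vanish only if the products of adjacent vertices do. The case `p = 1` or `q = 1`
corresponds to the deletion of `a` or `b`. -/
theorem mul_eq_zero_of_triangle {D : Type*} [CommRing D] [NoZeroDivisors D] {a b p q : D}
    (h1 : a * b = 0) (h2 : a * p + b * q = 0) : a * p = 0 ∧ b * q = 0 := by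
  rcases mul_eq_zero.1 h1 with rfl | rfl <;> simpa using h2

theorem ite_dvd_ite_of_triangle {M : Type*} [CommMonoid M] (a b : M) {p q r p' q' r' : Prop}
    [Decidable (r ∧ p)] [Decidable (r ∧ q)] [Decidable (r' ∧ p')] [Decidable (r' ∧ q')]
    (hp : p → p') (hq : q → q') (hr : r → r') (h : ¬ (p' ∧ q' ∧ r')) :
    (if r' ∧ p' then a else if r' ∧ q' then b else a * b) ∣
      if r ∧ p then a else if r ∧ q then b else a * b := by
  have h1 := dvd_mul_right a b
  have h2 := dvd_mul_left b a
  split_ifs <;> first | assumption | exact dvd_rfl | (exfalso; tauto)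

/-- With `p = b` and `s = e`, three sums of products of consecutive elements of a pentagon
`a, b, c, d, e` vanish only if all these products do. The case `p = 1` or `s = 1` corresponds to
the deletion of `a` or `d`. -/
theorem mul_eq_zero_of_pentagon {D : Type*} [CommRing D] [NoZeroDivisors D] {a b c d e p s : D}
    (h1 : a * p = 0) (h2 : c * d + e * a = 0) (h3 : b * c + d * s = 0) (hp : p = 0 → b = 0)
    (hs : s = 0 → e = 0) : c * d = 0 ∧ e * a = 0 ∧ b * c = 0 ∧ d * s = 0 := by
  rcases mul_eq_zero.1 h1 with rfl | h1
  · have h2' : c * d = 0 := by simpa using h2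
    rcases mul_eq_zero.1 h2' with rfl | rfl <;> simpa using h3
  · have h3' : d * s = 0 := by simpa [hp h1] using h3
    rcases mul_eq_zero.1 h3' with rfl | h3'
    · simpa [hp h1] using h2
    · simpa [hp h1, hs h3', h3'] using h2

theorem radical_span_eq_radical_restrictedIdeal {K : Type v} [Field K] {W N : Finset V} {m : ℕ}
    {f : ℕ → MvPolynomial V K} (h1 : ∀ i < m, f i ∈ G.restrictedIdeal K W N)
    (h2 : ∀ P : Ideal (MvPolynomial V K), P.IsPrime → (∀ i < m, f i ∈ P) →
      G.restrictedIdeal K W N ≤ P) :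
    (Ideal.span (f '' Set.Iio m)).radical = (G.restrictedIdeal K W N).radical := by
  refine le_antisymm (Ideal.radical_mono (Ideal.span_le.2 ?_)) ?_
  · rintro _ ⟨i, hi, rfl⟩
    exact h1 i hi
  · rw [Ideal.radical_eq_sInf (Ideal.span _)]
    refine le_sInf fun P hP => (hP.2.radical_le_iff).2 (h2 P hP.2 fun i hi => ?_)
    exact hP.1 (Ideal.subset_span ⟨i, hi, rfl⟩)

theorem IsCycleOn.restrictedIdeal_le_iff {K : Type v} [Field K] {W N : Finset V} {n : ℕ}
    {z : ℕ → V} (h : G.IsCycleOn W (n + 2) z) (hN : N ⊆ W) {J : Ideal (MvPolynomial V K)} :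
    G.restrictedIdeal K W N ≤ J ↔ (∀ i < n + 1, X (z i) * X (z (i + 1)) ∈ J) ∧
      X (z (n + 1)) * X (z 0) ∈ J ∧ ∀ i < n + 2, z i ∈ N → X (z i) ∈ J := by
  rw [SimpleGraph.restrictedIdeal_le_iff]
  constructor
  · rintro ⟨h1, h2⟩
    exact ⟨fun i hi => h1 _ (h.mem (by omega)) _ (h.mem (by omega)) (h.adj_succ (by omega)),
      h1 _ (h.mem (by omega)) _ (h.mem (by omega)) (h.adj_zero (by omega)), fun i _ => h2 _⟩
  · rintro ⟨h1, h2, h3⟩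
    have key : ∀ i j, i < j → j < n + 2 → G.Adj (z i) (z j) → X (z i) * X (z j) ∈ J := by
      intro i j hij hj hadj
      rcases (h.adj_iff i j hij hj).1 hadj with rfl | ⟨rfl, hj'⟩
      · exact h1 i (by omega)
      · rw [show j = n + 1 by omega, mul_comm]; exact h2
    refine ⟨fun x hx y hy hxy => ?_, fun v hv => ?_⟩
    · obtain ⟨i, hi, rfl⟩ := (h.mem_iff x).1 hx
      obtain ⟨j, hj, rfl⟩ := (h.mem_iff y).1 hy
      rcases lt_trichotomy i j with hij | rfl | hij
      · exact key i j hij hj hxy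
      · exact absurd rfl hxy.ne
      · rw [mul_comm]; exact key j i hij hi hxy.symm
    · obtain ⟨i, hi, rfl⟩ := (h.mem_iff v).1 (hN hv)
      exact h3 i hi hv

section Families

variable {W : Finset V} {z : ℕ → V} {k : ℕ}

theorem IsCycleOn.card [DecidableEq V] {n : ℕ} (h : G.IsCycleOn W n z) : W.card = n := by
  have : W = (Finset.range n).image z := by
    ext v
    simp [h.mem_iff]
  rw [this, h.card_image (fun i hi => Finset.mem_range.1 hi), Finset.card_range]

theorem IsCycleOn.eq_one_of_three (h : G.IsCycleOn W 3 z) (hk : G.WellCoveredOn W k) : k = 1 := by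
  have := hk {z 0} (isMaxIndepIn_iff.2 ⟨by simpa using h.mem (by omega), by simp, ?_⟩)
  · simpa using this.symm
  · intro w hw hw0
    obtain ⟨i, hi, rfl⟩ := (h.mem_iff w).1 hw
    have : i ≠ 0 := by rintro rfl; simp at hw0
    exact ⟨z 0, by simp, (h.adj_iff 0 i (by omega) hi).2 (by omega)⟩

theorem IsCycleOn.eq_two_of_five [DecidableEq V] (h : G.IsCycleOn W 5 z)
    (hk : G.WellCoveredOn W k) : k = 2 := by
  have := hk (({0, 2} : Finset ℕ).image z) (isMaxIndepIn_iff.2 ⟨?_,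
    h.isIndepSet (by simp) (by simp), ?_⟩)
  · rw [h.card_image (by simp)] at this
    simpa using this.symm
  · intro v hv
    obtain ⟨i, hi, rfl⟩ := Finset.mem_image.1 hv
    exact h.mem (by simp at hi; omega)
  · intro w hw hw0
    obtain ⟨i, hi, rfl⟩ := (h.mem_iff w).1 hw
    have h0 : i ≠ 0 := by rintro rfl; simp at hw0
    have h2 : i ≠ 2 := by rintro rfl; simp at hw0
    obtain rfl | rfl | rfl : i = 1 ∨ i = 3 ∨ i = 4 := by omega
    · exact ⟨z 0, by simp, h.adj_succ (by omega)⟩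
    · exact ⟨z 2, by simp, h.adj_succ (by omega)⟩
    · exact ⟨z 0, by simp, (h.adj_zero (by omega)).symm⟩

/-- A triangle `x₀, x₁, x₂` has the generating family `x₀ * x₁`, `x₀ * x₂ + x₁ * x₂`, in which some of
the products are replaced by deleted vertices that they contain. The independence number of a
triangle is one, so at least one vertex stays. -/
theorem HasGeneratingFamily.of_isCycleOn_three [DecidableEq V] {K : Type v} [Field K]
    (h : G.IsCycleOn W 3 z) :
    G.HasGeneratingFamily K W := by
  classical
  intro k hk
  have hk1 := h.eq_one_of_three hk
  have hNW : ∀ N, G.Removable W k N → N ⊆ W ∧ ¬ (z 0 ∈ N ∧ z 1 ∈ N ∧ z 2 ∈ N) := by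
    refine fun N hN => ⟨hN.subset, fun ⟨h0, h1, h2⟩ => ?_⟩
    have hWN : W \ N = ∅ := by
      rw [Finset.sdiff_eq_empty_iff_subset]
      intro v hv
      obtain ⟨i, hi, rfl⟩ := (h.mem_iff v).1 hv
      interval_cases i <;> assumption
    have := hN.wellCoveredOn ∅ (isMaxIndepIn_iff.2 ⟨by simp, by simp, by simp [hWN]⟩)
    simp at this
    omega
  let f : Finset V → ℕ → MvPolynomial V K := fun N i =>
    if i = 0 then
      if z 2 ∈ N ∧ z 0 ∈ N then X (z 0) else if z 2 ∈ N ∧ z 1 ∈ N then X (z 1)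
      else X (z 0) * X (z 1)
    else if z 2 ∈ N then X (z 2)
      else (if z 0 ∈ N then X (z 0) else X (z 0) * X (z 2)) +
        (if z 1 ∈ N then X (z 1) else X (z 1) * X (z 2))
  have hrad : ∀ N, G.Removable W k N →
      (Ideal.span (f N '' Set.Iio 2)).radical = (G.restrictedIdeal K W N).radical := by
    intro N hN
    obtain ⟨hsub, hne⟩ := hNW N hN
    obtain ⟨h1, h2, h3⟩ := (h.restrictedIdeal_le_iff (K := K) hsub).1 le_rfl
    have h01 := h1 0 (by omega)
    have h12 := h1 1 (by omega)
    refine radical_span_eq_radical_restrictedIdeal (fun i hi => ?_) fun P hP hf => ?_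
    · obtain rfl | rfl : i = 0 ∨ i = 1 := by omega
      · simp only [f, if_true]
        split_ifs with h4 h5
        · exact h3 0 (by omega) h4.2
        · exact h3 1 (by omega) h5.2
        · exact h01
      · simp only [f, one_ne_zero, if_false]
        have h20 : X (z 0) * X (z 2) ∈ G.restrictedIdeal K W N := by rw [mul_comm]; exact h2
        split_ifs with h4 h5 h6 h6
        · exact h3 2 (by omega) h4
        · exact Ideal.add_mem _ (h3 0 (by omega) h5) (h3 1 (by omega) h6)
        · exact Ideal.add_mem _ (h3 0 (by omega) h5) h12
        · exact Ideal.add_mem _ h20 (h3 1 (by omega) h6)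
        · exact Ideal.add_mem _ h20 h12
    · have hf0 := hf 0 (by omega)
      have hf1 := hf 1 (by omega)
      rw [h.restrictedIdeal_le_iff hsub]
      -- compute in the domain obtained by dividing by `P`
      simp only [← Ideal.Quotient.eq_zero_iff_mem] at hf0 hf1 ⊢
      have hdom : IsDomain (MvPolynomial V K ⧸ P) := Ideal.Quotient.isDomain P
      set q := Ideal.Quotient.mk P
      suffices hs : q (X (z 0)) * q (X (z 1)) = 0 ∧ q (X (z 1)) * q (X (z 2)) = 0 ∧
          q (X (z 2)) * q (X (z 0)) = 0 ∧ (z 0 ∈ N → q (X (z 0)) = 0) ∧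
          (z 1 ∈ N → q (X (z 1)) = 0) ∧ (z 2 ∈ N → q (X (z 2)) = 0) by
        obtain ⟨a1, a2, a3, a4, a5, a6⟩ := hs
        refine ⟨fun i hi => ?_, ?_, fun i hi hiN => ?_⟩
        · rw [map_mul]; interval_cases i <;> assumption
        · rw [map_mul]; exact a3
        · interval_cases i
          exacts [a4 hiN, a5 hiN, a6 hiN]
      simp only [f, if_true, one_ne_zero, if_false] at hf0 hf1
      clear_value q
      by_cases n2 : z 2 ∈ N
      · simp only [n2, if_true] at hf1
        by_cases n0 : z 0 ∈ N
        · have n1 : z 1 ∉ N := fun n1 => hne ⟨n0, n1, n2⟩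
          simp only [n0, n2, true_and, if_true] at hf0
          simp [n1, hf0, hf1]
        · by_cases n1 : z 1 ∈ N
          · simp only [n0, n1, n2, and_true, and_false, if_true, if_false] at hf0
            simp [n0, hf0, hf1]
          · simp only [n0, n1, and_false, if_false, map_mul] at hf0
            simp only [n0, n1, hf0, hf1]
            simp
      · simp only [n2, false_and, if_false, map_mul, map_add] at hf0 hf1
        have key := mul_eq_zero_of_triangle (p := if z 0 ∈ N then 1 else q (X (z 2)))
          (q := if z 1 ∈ N then 1 else q (X (z 2))) hf0 (by
            rw [← hf1]; split_ifs <;> simp)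
        obtain ⟨k1, k2⟩ := key
        refine ⟨hf0, ?_, ?_, fun n0 => by simpa [n0] using k1, fun n1 => by simpa [n1] using k2,
          fun h => absurd h n2⟩
        · split_ifs at k2
          · rw [← mul_one (q (X (z 1))), k2, zero_mul]
          · exact k2
        · rw [mul_comm]
          split_ifs at k1
          · rw [← mul_one (q (X (z 0))), k1, zero_mul]
          · exact k1
  refine ⟨2, f, by rw [h.card, hk1], hrad, fun N N' hN hN' hNN' j hj => ?_⟩
  obtain rfl | rfl : j = 0 ∨ j = 1 := by omega
  · have hne := (hNW N' hN').2
    have hmem : f N' 0 ∈ (Ideal.span (f N' '' Set.Iio (0 + 1))).radical :=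
      mem_radical_span (by omega)
    refine Ideal.mem_of_dvd _ ?_ hmem
    have hdvd := ite_dvd_ite_of_triangle (X (z 0) : MvPolynomial V K) (X (z 1)) (@hNN' (z 0))
      (@hNN' (z 1)) (@hNN' (z 2)) hne
    exact hdvd
  · rw [show 1 + 1 = 2 from rfl, hrad N' hN']
    refine Ideal.radical_mono (restrictedIdeal_mono subset_rfl hNN') ?_
    rw [← hrad N hN]
    exact mem_radical_span hj

/-- A pentagon `x₀, …, x₄` in which at most the nonadjacent vertices `x₀` and `x₃` may be deleted has
the generating family `x₀ * x₁`, `x₂ * x₃ + x₄ * x₀`, `x₁ * x₂ + x₃ * x₄`, where the deletion of `x₀`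
or `x₃` replaces the product `x₀ * x₁` or `x₃ * x₄` by `x₀` or `x₃`. -/
theorem HasGeneratingFamily.of_isCycleOn_five [DecidableEq V] {K : Type v} [Field K]
    (h : G.IsCycleOn W 5 z)
    (hB : ∀ v ∈ W, (∃ u ∉ W, G.Adj u v) → v = z 0 ∨ v = z 3) :
    G.HasGeneratingFamily K W := by
  classical
  intro k hk
  have hk2 := h.eq_two_of_five hk
  let f : Finset V → ℕ → MvPolynomial V K := fun N i =>
    if i = 0 then if z 0 ∈ N then X (z 0) else X (z 0) * X (z 1)
    else if i = 1 then X (z 2) * X (z 3) + X (z 4) * X (z 0)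
    else X (z 1) * X (z 2) + if z 3 ∈ N then X (z 3) else X (z 3) * X (z 4)
  have hrad : ∀ N, G.Removable W k N →
      (Ideal.span (f N '' Set.Iio 3)).radical = (G.restrictedIdeal K W N).radical := by
    intro N hN
    have hsub := hN.subset
    have hN' : ∀ i < 5, z i ∈ N → i = 0 ∨ i = 3 := fun i hi hiN =>
      (hB _ (hsub hiN) (hN.exists_adj _ hiN)).imp (h.inj i hi 0 (by omega))
        (h.inj i hi 3 (by omega))
    obtain ⟨h1, h2, h3⟩ := (h.restrictedIdeal_le_iff (K := K) hsub).1 le_rfl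
    refine radical_span_eq_radical_restrictedIdeal (fun i hi => ?_) fun P hP hf => ?_
    · obtain rfl | rfl | rfl : i = 0 ∨ i = 1 ∨ i = 2 := by omega
      · simp only [f, if_true]
        split_ifs with h4
        · exact h3 0 (by omega) h4
        · exact h1 0 (by omega)
      · exact Ideal.add_mem _ (h1 2 (by omega)) h2
      · refine Ideal.add_mem _ (h1 1 (by omega)) ?_
        split_ifs with h4
        · exact h3 3 (by omega) h4
        · exact h1 3 (by omega)
    · have hf0 := hf 0 (by omega)
      have hf1 := hf 1 (by omega)
      have hf2 := hf 2 (by omega)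
      rw [h.restrictedIdeal_le_iff hsub]
      simp only [← Ideal.Quotient.eq_zero_iff_mem] at hf0 hf1 hf2 ⊢
      have hdom : IsDomain (MvPolynomial V K ⧸ P) := Ideal.Quotient.isDomain P
      set q := Ideal.Quotient.mk P
      suffices hs : q (X (z 0)) * q (X (z 1)) = 0 ∧ q (X (z 1)) * q (X (z 2)) = 0 ∧
          q (X (z 2)) * q (X (z 3)) = 0 ∧ q (X (z 3)) * q (X (z 4)) = 0 ∧
          q (X (z 4)) * q (X (z 0)) = 0 ∧ (z 0 ∈ N → q (X (z 0)) = 0) ∧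
          (z 3 ∈ N → q (X (z 3)) = 0) by
        obtain ⟨a1, a2, a3, a4, a5, a6, a7⟩ := hs
        refine ⟨fun i hi => ?_, ?_, fun i hi hiN => ?_⟩
        · rw [map_mul]; interval_cases i <;> assumption
        · rw [map_mul]; exact a5
        · obtain rfl | rfl := hN' i hi hiN
          exacts [a6 hiN, a7 hiN]
      simp only [f, if_true, one_ne_zero, if_false, OfNat.ofNat_ne_zero, OfNat.ofNat_ne_one,
        map_add, map_mul] at hf0 hf1 hf2
      clear_value q
      have hf0' : q (X (z 0)) * (if z 0 ∈ N then 1 else q (X (z 1))) = 0 := by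
        rw [← hf0]; split_ifs <;> simp
      obtain ⟨k1, k2, k3, k4⟩ := mul_eq_zero_of_pentagon hf0' hf1
        (b := q (X (z 1))) (s := if z 3 ∈ N then 1 else q (X (z 4)))
        (by rw [← hf2]; split_ifs <;> simp)
        (fun h => by split_ifs at h; exacts [absurd h one_ne_zero, h])
        (fun h => by split_ifs at h; exacts [absurd h one_ne_zero, h])
      refine ⟨?_, k3, k1, ?_, k2, fun n0 => by simpa [n0] using hf0',
        fun n3 => by simpa [n3] using k4⟩
      · split_ifs at hf0'
        · rw [← mul_one (q (X (z 0))), hf0', zero_mul]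
        · exact hf0'
      · split_ifs at k4
        · rw [← mul_one (q (X (z 3))), k4, zero_mul]
        · exact k4
  refine ⟨3, f, by rw [h.card, hk2], hrad, fun N N' hN hN' hNN' j hj => ?_⟩
  obtain rfl | rfl | rfl : j = 0 ∨ j = 1 ∨ j = 2 := by omega
  · have hmem : f N' 0 ∈ (Ideal.span (f N' '' Set.Iio (0 + 1))).radical :=
      mem_radical_span (by omega)
    refine Ideal.mem_of_dvd _ ?_ hmem
    have h0 := @hNN' (z 0)
    simp only [f, if_true]
    clear hmem
    generalize (X (z 0) : MvPolynomial V K) = a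
    generalize (X (z 1) : MvPolynomial V K) = b
    split_ifs
    all_goals first | (exfalso; tauto) | exact dvd_rfl | exact dvd_mul_right a b
  · exact mem_radical_span (g := f N') (n := 1 + 1) (i := 1) (by omega)
  · rw [show 2 + 1 = 3 from rfl, hrad N' hN']
    refine Ideal.radical_mono (restrictedIdeal_mono subset_rfl hNN') ?_
    rw [← hrad N hN]
    exact mem_radical_span hj

end Families

/-! ### Graphs with exactly one cycle -/

theorem HasExactlyOneCycle.mem_support_iff (hG : G.HasExactlyOneCycle) {x y : V}
    {c : G.Walk x x} {d : G.Walk y y} (hc : c.IsCycle) (hd : d.IsCycle) (v : V) :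
    v ∈ c.support ↔ v ∈ d.support := by
  rw [← Walk.mem_verts_toSubgraph, ← Walk.mem_verts_toSubgraph,
    hG.unique ⟨x, c, hc, rfl⟩ ⟨y, d, hd, rfl⟩]

/-- The values `z 0, …, z l` are the consecutive vertices of a path, not necessarily an induced one.
The values `z i` for `i > l` are irrelevant. -/
structure IsPathOn (G : SimpleGraph V) (l : ℕ) (z : ℕ → V) : Prop where
  inj : ∀ i ≤ l, ∀ j ≤ l, z i = z j → i = j
  adj : ∀ i < l, G.Adj (z i) (z (i + 1))

/-- The walk runs backwards, so that appending a vertex to the path is `Walk.cons`. -/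
theorem IsPathOn.exists_walk {z : ℕ → V} {l : ℕ} (h : G.IsPathOn l z) :
    ∃ p : G.Walk (z l) (z 0), p.IsPath ∧ (∀ v, v ∈ p.support ↔ ∃ i ≤ l, z i = v) ∧
      ∀ e ∈ p.edges, ∃ i < l, e = s(z i, z (i + 1)) := by
  induction l with
  | zero => exact ⟨Walk.nil, by simp, by simp [eq_comm], by simp⟩
  | succ l ih =>
    obtain ⟨p, hp, hsupp, hedge⟩ := ih
      ⟨fun i hi j hj => h.inj i (by omega) j (by omega), fun i hi => h.adj i (by omega)⟩
    refine ⟨Walk.cons (h.adj l (by omega)).symm p, ?_, fun v => ?_, fun e he => ?_⟩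
    · rw [Walk.cons_isPath_iff, hsupp]
      refine ⟨hp, ?_⟩
      rintro ⟨i, hi, hil⟩
      have := h.inj i (by omega) (l + 1) le_rfl hil
      omega
    · rw [Walk.support_cons, List.mem_cons, hsupp]
      constructor
      · rintro (rfl | ⟨i, hi, rfl⟩)
        exacts [⟨l + 1, le_rfl, rfl⟩, ⟨i, by omega, rfl⟩]
      · rintro ⟨i, hi, rfl⟩
        rcases hi.lt_or_eq with hi | rfl
        exacts [Or.inr ⟨i, by omega, rfl⟩, Or.inl rfl]
    · rw [Walk.edges_cons, List.mem_cons] at he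
      rcases he with rfl | he
      · exact ⟨l, by omega, Sym2.eq_swap⟩
      · obtain ⟨i, hi, rfl⟩ := hedge e he
        exact ⟨i, by omega, rfl⟩

theorem IsPathOn.exists_isCycle {z : ℕ → V} {l : ℕ} (h : G.IsPathOn l z) (hl : 2 ≤ l)
    (hadj : G.Adj (z 0) (z l)) :
    ∃ c : G.Walk (z 0) (z 0), c.IsCycle ∧ ∀ v, v ∈ c.support ↔ ∃ i ≤ l, z i = v := by
  obtain ⟨p, hp, hsupp, hedge⟩ := h.exists_walk
  refine ⟨Walk.cons hadj p, ?_, fun v => ?_⟩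
  · rw [Walk.cons_isCycle_iff]
    refine ⟨hp, fun he => ?_⟩
    obtain ⟨i, hi, hi'⟩ := hedge _ he
    rw [Sym2.eq_iff] at hi'
    rcases hi' with ⟨h1, h2⟩ | ⟨h1, h2⟩
    · have := h.inj 0 (by omega) i (by omega) h1
      have := h.inj l le_rfl (i + 1) (by omega) h2
      omega
    · have := h.inj l le_rfl i (by omega) h2
      omega
  · rw [Walk.support_cons, List.mem_cons, hsupp]
    constructor
    · rintro (rfl | h)
      exacts [⟨0, by omega, rfl⟩, h]
    · exact Or.inr

theorem IsPathOn.shift {z : ℕ → V} {l : ℕ} (h : G.IsPathOn l z) {i j : ℕ} (hij : i + j ≤ l) :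
    G.IsPathOn j fun t => z (i + t) :=
  ⟨fun a ha b hb hab => by have := h.inj (i + a) (by omega) (i + b) (by omega) hab; omega,
    fun a ha => h.adj (i + a) (by omega)⟩

theorem IsPathOn.lt_card {W : Finset V} {z : ℕ → V} {l : ℕ} (h : G.IsPathOn l z)
    (hW : ∀ i ≤ l, z i ∈ W) : l < W.card := by
  have := Finset.card_le_card_of_injOn (s := Finset.range (l + 1)) (t := W) z
    (fun i hi => hW i (by simpa [Nat.lt_succ_iff] using hi))
    fun i hi j hj hij => h.inj i (by simpa [Nat.lt_succ_iff] using hi) j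
      (by simpa [Nat.lt_succ_iff] using hj) hij
  simpa using this

/-- In a set of vertices where all degrees are at least two, every longest path closes up to a
cycle, because each of its end vertices has a second neighbour on it. -/
theorem HasExactlyOneCycle.eq_of_adj_of_longest (hG : G.HasExactlyOneCycle) {W : Finset V}
    (hdeg : ∀ v ∈ W, ∀ a, ∃ u ∈ W, u ≠ a ∧ G.Adj v u) {l : ℕ} {z : ℕ → V} (hz : G.IsPathOn l z)
    (hzW : ∀ i ≤ l, z i ∈ W)
    (hmax : ∀ z', G.IsPathOn (l + 1) z' → ¬ ∀ i ≤ l + 1, z' i ∈ W) :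
    2 ≤ l ∧ G.Adj (z 0) (z l) ∧ ∀ u ∈ W, G.Adj (z 0) u → u = z 1 ∨ u = z l := by
  -- neighbours of the ends lie on the path
  have h0 : ∀ u ∈ W, G.Adj (z 0) u → ∃ i ≤ l, z i = u := by
    intro u hu hadj
    by_contra! hcon
    refine hmax (fun i => if i = 0 then u else z (i - 1)) ⟨fun i hi j hj hij => ?_, fun i hi => ?_⟩
      fun i hi => ?_
    · split_ifs at hij with h1 h2 h2
      · omega
      · exact absurd hij.symm (hcon _ (by omega))
      · exact absurd hij (hcon _ (by omega))
      · have := hz.inj _ (by omega) _ (by omega) hij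
        omega
    · by_cases h1 : i = 0
      · simpa [h1] using hadj.symm
      · have := hz.adj (i - 1) (by omega)
        rw [Nat.sub_add_cancel (by omega)] at this
        simpa [h1] using this
    · split_ifs with h1
      exacts [hu, hzW _ (by omega)]
  have hl : ∀ u ∈ W, G.Adj (z l) u → ∃ i ≤ l, z i = u := by
    intro u hu hadj
    by_contra! hcon
    refine hmax (fun i => if i = l + 1 then u else z i) ⟨fun i hi j hj hij => ?_, fun i hi => ?_⟩
      fun i hi => ?_
    · split_ifs at hij with h1 h2 h2
      · omega
      · exact absurd hij.symm (hcon _ (by omega))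
      · exact absurd hij (hcon _ (by omega))
      · exact hz.inj _ (by omega) _ (by omega) hij
    · by_cases h1 : i = l
      · simpa [h1] using hadj
      · have := hz.adj i (by omega)
        simpa [h1, show i ≠ l + 1 by omega] using this
    · split_ifs with h1
      exacts [hu, hzW _ (by omega)]
  obtain ⟨u, hu, hul, hlu⟩ := hdeg (z l) (hzW l le_rfl) (z (l - 1))
  obtain ⟨j, hj, rfl⟩ := hl u hu hlu
  have hjl : j ≠ l := by rintro rfl; exact hlu.ne rfl
  have hjl' : j ≠ l - 1 := by rintro rfl; exact hul rfl
  obtain ⟨d, hd, hd'⟩ := (hz.shift (i := j) (j := l - j) (by omega)).exists_isCycle (by omega)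
    (by rw [show j + (l - j) = l by omega]; exact hlu.symm)
  have key : ∀ u ∈ W, G.Adj (z 0) u → u = z 1 ∨ u = z l := by
    intro u hu hadj
    obtain ⟨i, hi, rfl⟩ := h0 u hu hadj
    have hi0 : i ≠ 0 := by rintro rfl; exact hadj.ne rfl
    by_cases hi1 : i = 1
    · exact Or.inl (by rw [hi1])
    obtain ⟨c, hc, hc'⟩ := (hz.shift (i := 0) (j := i) (by omega)).exists_isCycle (by omega)
      (by simpa using hadj)
    obtain ⟨t, ht, htl⟩ := (hc' (z l)).1 ((hG.mem_support_iff hc hd _).2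
      ((hd' _).2 ⟨l - j, le_rfl, by rw [show j + (l - j) = l by omega]⟩))
    have := hz.inj _ (by omega) l le_rfl htl
    exact Or.inr (by rw [show i = l by omega])
  obtain ⟨u, hu, hu1, h0u⟩ := hdeg (z 0) (hzW 0 (by omega)) (z 1)
  exact ⟨by omega, ((key u hu h0u).resolve_left hu1) ▸ h0u, key⟩

theorem exists_longest_isPathOn {W : Finset V} (hW : W.Nonempty) :
    ∃ l z, G.IsPathOn l z ∧ (∀ i ≤ l, z i ∈ W) ∧
      ∀ z', G.IsPathOn (l + 1) z' → ¬ ∀ i ≤ l + 1, z' i ∈ W := by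
  classical
  obtain ⟨v, hv⟩ := hW
  have h := Nat.findGreatest_spec (P := fun l => ∃ z, G.IsPathOn l z ∧ ∀ i ≤ l, z i ∈ W)
    (m := 0) (n := W.card) (by omega)
    ⟨fun _ => v, ⟨fun i hi j hj _ => by omega, fun i hi => by omega⟩, fun _ _ => hv⟩
  obtain ⟨z, hz, hzW⟩ := h
  refine ⟨_, z, hz, hzW, fun z' hz' hz'W => ?_⟩
  exact Nat.findGreatest_is_greatest (Nat.lt_succ_self _) (hz'.lt_card hz'W).le ⟨z', hz', hz'W⟩

/-- Rotation of a closed path. -/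
theorem IsPathOn.rotate {z : ℕ → V} {l : ℕ} (h : G.IsPathOn l z) (hadj : G.Adj (z 0) (z l))
    {r : ℕ} (hr : r ≤ l) :
    G.IsPathOn l fun i => if i + r ≤ l then z (i + r) else z (i + r - (l + 1)) := by
  refine ⟨fun i hi j hj hij => ?_, fun i hi => ?_⟩
  · split_ifs at hij
    all_goals
      have := h.inj _ (by omega) _ (by omega) hij
      omega
  · split_ifs with h1 h2 h2
    · have := h.adj (i + r) (by omega)
      rwa [show i + 1 + r = i + r + 1 by omega]
    · rw [show i + 1 + r - (l + 1) = 0 by omega, show i + r = l by omega]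
      exact hadj.symm
    · omega
    · have := h.adj (i + r - (l + 1)) (by omega)
      rwa [show i + 1 + r - (l + 1) = i + r - (l + 1) + 1 by omega]

/-- A vertex set of minimal degree at least two in a graph with exactly one cycle is that cycle, and
the cycle has no chords. -/
theorem HasExactlyOneCycle.exists_isCycleOn (hG : G.HasExactlyOneCycle) {W : Finset V}
    (hW : W.Nonempty) (hdeg : ∀ v ∈ W, ∀ a, ∃ u ∈ W, u ≠ a ∧ G.Adj v u) :
    ∃ n z, 3 ≤ n ∧ G.IsCycleOn W n z := by
  classical
  obtain ⟨l, z, hz, hzW, hmax⟩ := exists_longest_isPathOn (G := G) hW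
  obtain ⟨hl, hadj, -⟩ := hG.eq_of_adj_of_longest hdeg hz hzW hmax
  -- all neighbours of a vertex of the cycle are adjacent to it along the cycle
  have key : ∀ i ≤ l, ∀ u ∈ W, G.Adj (z i) u →
      (u = if i < l then z (i + 1) else z 0) ∨ u = if i = 0 then z l else z (i - 1) := by
    intro i hi u hu hiu
    obtain ⟨-, -, h⟩ := hG.eq_of_adj_of_longest hdeg (hz.rotate hadj hi)
      (fun j hj => by split_ifs <;> exact hzW _ (by omega)) hmax
    have := h u hu (by simpa [hi] using hiu)
    refine this.imp (fun h => ?_) fun h => ?_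
    · rw [h]
      by_cases hil : i < l
      · rw [if_pos hil, if_pos (by omega), add_comm]
      · rw [if_neg hil, if_neg (by omega), show 1 + i - (l + 1) = 0 by omega]
    · rw [h]
      by_cases hi0 : i = 0
      · rw [if_pos hi0, if_pos (by omega), hi0, add_zero]
      · rw [if_neg hi0, if_neg (by omega), show l + i - (l + 1) = i - 1 by omega]
  have hcl : ∀ i ≤ l, ∀ u ∈ W, G.Adj (z i) u → ∃ j ≤ l, z j = u := by
    intro i hi u hu hiu
    rcases key i hi u hu hiu with h | h <;> split_ifs at h <;>
      exact ⟨_, by omega, h.symm⟩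
  obtain ⟨c, hc, hc'⟩ := hz.exists_isCycle hl hadj
  refine ⟨l + 1, z, by omega, fun v => ⟨fun hv => ?_, ?_⟩, fun i hi j hj => hz.inj i (by omega) j
    (by omega), fun i j hij hj => ⟨fun h => ?_, ?_⟩⟩
  · -- otherwise there is a second cycle among the remaining vertices
    by_contra! hcon
    have hW' : (W.filter fun v => ∀ i ≤ l, z i ≠ v).Nonempty :=
      ⟨v, Finset.mem_filter.2 ⟨hv, fun i hi => hcon i (by omega)⟩⟩
    have hdeg' : ∀ v ∈ W.filter fun v => ∀ i ≤ l, z i ≠ v, ∀ a,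
        ∃ u ∈ W.filter fun v => ∀ i ≤ l, z i ≠ v, u ≠ a ∧ G.Adj v u := by
      intro v hv a
      rw [Finset.mem_filter] at hv
      obtain ⟨u, hu, hua, hvu⟩ := hdeg v hv.1 a
      refine ⟨u, Finset.mem_filter.2 ⟨hu, fun i hi hiu => ?_⟩, hua, hvu⟩
      obtain ⟨j, hj, hjv⟩ := hcl i hi v hv.1 (hiu ▸ hvu.symm)
      exact hv.2 j hj hjv
    obtain ⟨l', z', hz', hzW', hmax'⟩ := exists_longest_isPathOn (G := G) hW'
    obtain ⟨hl', hadj', -⟩ := hG.eq_of_adj_of_longest hdeg' hz' hzW' hmax'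
    obtain ⟨d, hd, hd'⟩ := hz'.exists_isCycle hl' hadj'
    obtain ⟨i, hi, hi'⟩ := (hc' (z' 0)).1 ((hG.mem_support_iff hc hd _).2 ((hd' _).2
      ⟨0, by omega, rfl⟩))
    exact (Finset.mem_filter.1 (hzW' 0 (by omega))).2 i hi hi'
  · rintro ⟨i, hi, rfl⟩
    exact hzW i (by omega)
  · rcases key i (by omega) (z j) (hzW j (by omega)) h with h | h <;> split_ifs at h <;>
      have := hz.inj _ (by omega) _ (by omega) h <;> omega
  · rintro (rfl | ⟨rfl, hj'⟩)
    · exact hz.adj i (by omega)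
    · rw [show j = l by omega]; exact hadj

section UniqueCycle

variable {W : Finset V} {n k : ℕ} {z : ℕ → V}

theorem IsCycleOn.isPathOn (h : G.IsCycleOn W (n + 1) z) : G.IsPathOn n z :=
  ⟨fun i hi j hj => h.inj i (by omega) j (by omega), fun i hi => h.adj_succ (by omega)⟩

theorem IsCycleOn.exists_isCycle (h : G.IsCycleOn W (n + 3) z) :
    ∃ c : G.Walk (z 0) (z 0), c.IsCycle ∧ ∀ v, v ∈ c.support ↔ v ∈ W := by
  obtain ⟨c, hc, hc'⟩ := h.isPathOn.exists_isCycle (by omega) (h.adj_zero (by omega)).symm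
  refine ⟨c, hc, fun v => ?_⟩
  rw [hc', h.mem_iff]
  exact exists_congr fun i => by rw [Nat.lt_succ_iff]

theorem IsCycleOn.rotate (h : G.IsCycleOn W n z) {r : ℕ} (hr : r < n) :
    G.IsCycleOn W n fun i => if i + r < n then z (i + r) else z (i + r - n) := by
  refine ⟨fun v => ?_, fun i hi j hj hij => ?_, fun i j hij hj => ?_⟩
  · rw [h.mem_iff]
    constructor
    · rintro ⟨i, hi, rfl⟩
      by_cases hir : r ≤ i
      · exact ⟨i - r, by omega, by simp [hir, hi]⟩
      · refine ⟨i + n - r, by omega, ?_⟩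
        rw [if_neg (by omega), show i + n - r + r - n = i by omega]
    · rintro ⟨i, hi, rfl⟩
      split_ifs with h1
      exacts [⟨_, h1, rfl⟩, ⟨_, by omega, rfl⟩]
  · split_ifs at hij
    all_goals
      have := h.inj _ (by omega) _ (by omega) hij
      omega
  · split_ifs with h1 h2 h2
    · rw [h.adj_iff _ _ (by omega) h2]; omega
    · rw [G.adj_comm, h.adj_iff _ _ (by omega) h1]; omega
    · omega
    · rw [h.adj_iff _ _ (by omega) (by omega)]; omega

/-- An edge with an end off the cycle is a bridge. -/
theorem HasExactlyOneCycle.not_reachable (hG : G.HasExactlyOneCycle)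
    (hz : G.IsCycleOn W (n + 3) z) {x y : V} (hx : x ∉ W) (hxy : G.Adj x y) :
    ¬ (G.deleteEdges {s(x, y)}).Reachable x y := by
  rw [← isBridge_iff, isBridge_iff_forall_cycle_notMem (G.mem_edgeSet.2 hxy)]
  intro v c hc hmem
  obtain ⟨d, hd, hd'⟩ := hz.exists_isCycle
  exact hx ((hd' x).1 ((hG.mem_support_iff hc hd x).1 (c.fst_mem_support_of_mem_edges hmem)))

/-- A component of the complement of the cycle is joined to the cycle by at most one edge: a second
one would allow a way around the first, which is a bridge. -/
theorem HasExactlyOneCycle.eq_of_reflTransGen (hG : G.HasExactlyOneCycle)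
    (hz : G.IsCycleOn W (n + 3) z) {x y a b : V}
    (hxy : Relation.ReflTransGen (fun u v => G.Adj u v ∧ v ∉ W) x y) (hx : x ∉ W) (ha : a ∈ W)
    (hb : b ∈ W) (hxa : G.Adj x a) (hyb : G.Adj y b) : x = y ∧ a = b := by
  by_contra hne
  refine hG.not_reachable hz hx hxa ?_
  have hout : y ∉ W ∧ (G.deleteEdges {s(x, a)}).Reachable x y := by
    clear hyb hne
    induction hxy with
    | refl => exact ⟨hx, Reachable.refl _⟩
    | tail _ h ih =>
      refine ⟨h.2, ih.2.trans (Adj.reachable ?_)⟩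
      rw [deleteEdges_adj]
      refine ⟨h.1, fun he => ?_⟩
      rw [Set.mem_singleton_iff, Sym2.eq_iff] at he
      rcases he with ⟨-, he⟩ | ⟨he, -⟩
      · exact h.2 (he ▸ ha)
      · exact ih.1 (he ▸ ha)
  have hcyc : ∀ i < n + 3, (G.deleteEdges {s(x, a)}).Reachable (z 0) (z i) := by
    intro i
    induction i with
    | zero => exact fun _ => Reachable.refl _
    | succ i ih =>
      refine fun hi => (ih (by omega)).trans (Adj.reachable ?_)
      rw [deleteEdges_adj]
      refine ⟨hz.adj_succ hi, fun h => ?_⟩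
      rw [Set.mem_singleton_iff, Sym2.eq_iff] at h
      rcases h with ⟨h, -⟩ | ⟨-, h⟩
      · exact hx (h ▸ hz.mem (by omega))
      · exact hx (h ▸ hz.mem (by omega))
  obtain ⟨i, hi, rfl⟩ := (hz.mem_iff a).1 ha
  obtain ⟨j, hj, rfl⟩ := (hz.mem_iff b).1 hb
  refine hout.2.trans ((Adj.reachable ?_).trans ((hcyc j hj).symm.trans (hcyc i hi)))
  rw [deleteEdges_adj]
  refine ⟨hyb, fun h => ?_⟩
  rw [Set.mem_singleton_iff, Sym2.eq_iff] at h
  rcases h with ⟨h, h'⟩ | ⟨h, -⟩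
  · exact hne ⟨h.symm, h'.symm⟩
  · exact hout.1 (h ▸ hz.mem hi)

/-! ### Excluding cycles by well-coveredness -/

/-- The path with three vertices is not well-covered. -/
theorem not_wellCoveredOn_path [DecidableEq V] {a b c : V} (hab : G.Adj a b) (hbc : G.Adj b c)
    (hac : ¬ G.Adj a c) (hne : a ≠ c) : ¬ G.WellCoveredOn {a, b, c} k := by
  intro h
  have h1 := h {b} (isMaxIndepIn_iff.2 ⟨by simp, by simp, ?_⟩)
  · have h2 := h.card_le (T := {a, c}) (by intro v; simp; tauto) (by
      intro x hx y hy hxy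
      simp only [Finset.coe_insert, Finset.coe_singleton, Set.mem_insert_iff,
        Set.mem_singleton_iff] at hx hy
      rcases hx with rfl | rfl <;> rcases hy with rfl | rfl
      exacts [absurd rfl hxy, hac, fun h => hac h.symm, absurd rfl hxy])
    rw [Finset.card_pair hne] at h2
    rw [Finset.card_singleton] at h1
    omega
  · intro w hw hwb
    simp only [Finset.mem_insert, Finset.mem_singleton] at hw hwb
    rcases hw with rfl | rfl | rfl
    exacts [⟨b, by simp, hab.symm⟩, absurd rfl hwb, ⟨b, by simp, hbc⟩]

/-- A cycle of length at least six and different from seven has an independent set whose link is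
the path on three consecutive vertices. -/
theorem IsCycleOn.not_wellCoveredOn [DecidableEq V] (h : G.IsCycleOn W n z) (hn : 6 ≤ n)
    (hn7 : n ≠ 7) : ¬ G.WellCoveredOn W k := by
  intro hk
  -- the alternate vertices from `4` on, where for odd `n` the gap between `4` and `7` is larger
  set s : Finset ℕ := (Finset.range n).filter fun i =>
    i = 4 ∨ (n % 2 = 0 ∧ 4 ≤ i ∧ i % 2 = 0) ∨ (n % 2 = 1 ∧ 7 ≤ i ∧ i % 2 = 1) with hs
  have hmem : ∀ i, i ∈ s ↔ i < n ∧
      (i = 4 ∨ (n % 2 = 0 ∧ 4 ≤ i ∧ i % 2 = 0) ∨ (n % 2 = 1 ∧ 7 ≤ i ∧ i % 2 = 1)) := fun i => by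
    rw [hs, Finset.mem_filter, Finset.mem_range]
  have hsn : ∀ i ∈ s, i < n := fun i hi => ((hmem i).1 hi).1
  refine not_wellCoveredOn_path (h.adj_succ (i := 0) (by omega)) (h.adj_succ (i := 1) (by omega))
    (fun hadj => ?_) (fun h02 => ?_) (hk.link (F := s.image z) ?_ (h.isIndepSet hsn ?_) ?_)
  · rw [h.adj_iff 0 _ (by omega) (by omega)] at hadj
    omega
  · have := h.inj 0 (by omega) _ (by omega) h02
    omega
  · intro v hv
    obtain ⟨i, hi, rfl⟩ := Finset.mem_image.1 hv
    exact h.mem (hsn i hi)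
  · intro i hi j hj hij
    rw [hmem] at hi hj
    omega
  · have hz : ∀ i < n, z i ∈ s.image z ↔ i ∈ s := fun i hi => by
      rw [Finset.mem_image]
      exact ⟨fun ⟨j, hj, hji⟩ => h.inj j (hsn j hj) i hi hji ▸ hj, fun hi => ⟨i, hi, rfl⟩⟩
    intro v
    constructor
    · intro hv
      obtain ⟨i, hi, rfl⟩ : ∃ i < 3, z i = v := by
        simp only [Finset.mem_insert, Finset.mem_singleton] at hv
        rcases hv with rfl | rfl | rfl
        exacts [⟨0, by omega, rfl⟩, ⟨1, by omega, rfl⟩, ⟨2, by omega, rfl⟩]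
      refine ⟨h.mem (by omega), ?_, fun f hf hadj => ?_⟩
      · rw [hz i (by omega), hmem]; omega
      · obtain ⟨j, hj, rfl⟩ := Finset.mem_image.1 hf
        rw [hmem] at hj
        rw [G.adj_comm, h.adj_iff i j (by omega) hj.1] at hadj
        omega
    · rintro ⟨hvW, hvs, hvadj⟩
      obtain ⟨i, hi, rfl⟩ := (h.mem_iff v).1 hvW
      rw [hz i hi, hmem] at hvs
      have hnext : ∀ j, j + 1 = i → j ∉ s := fun j hji hj =>
        hvadj (z j) (Finset.mem_image_of_mem z hj) (hji ▸ h.adj_succ (by omega))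
      have hprev : i + 1 ∉ s := fun hj =>
        hvadj (z (i + 1)) (Finset.mem_image_of_mem z hj) (h.adj_succ (hsn _ hj)).symm
      have hi3 : i < 3 := by
        by_contra hi3
        have := hnext (i - 1) (by omega)
        rw [hmem] at this hprev
        omega
      interval_cases i <;> simp

/-- If two adjacent vertices of a pentagon had neighbours `p` and `q` outside it, then the
components of `p` and `q` in the complement could be used to construct an independent set whose
link is the path on the other three vertices of the pentagon. -/
theorem HasExactlyOneCycle.not_exists_adj_of_five [Fintype V] [DecidableEq V]
    (hG : G.HasExactlyOneCycle) (hk : G.WellCoveredOn Finset.univ k) {F : Finset V}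
    (hF : G.IsLink F W) (hz : G.IsCycleOn W 5 z) :
    ¬ ((∃ p ∉ W, G.Adj p (z 0)) ∧ ∃ q ∉ W, G.Adj q (z 1)) := by
  classical
  rintro ⟨⟨p, hpW, hp⟩, q, hqW, hq⟩
  let r := fun u v => G.Adj u v ∧ v ∉ W
  set D : Finset V := Finset.univ.filter fun v =>
    Relation.ReflTransGen r p v ∨ Relation.ReflTransGen r q v with hD
  have hDmem : ∀ v, v ∈ D ↔ Relation.ReflTransGen r p v ∨ Relation.ReflTransGen r q v :=
    fun v => by rw [hD, Finset.mem_filter]; simp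
  have hne : z 0 ≠ z 1 := (hz.adj_succ (by omega)).ne
  have hout : ∀ x y, x ∉ W → Relation.ReflTransGen r x y → y ∉ W := by
    intro x y hx h
    induction h with
    | refl => exact hx
    | tail _ h _ => exact h.2
  have hDW : ∀ v ∈ D, v ∉ W := fun v hv => ((hDmem v).1 hv).elim (hout p v hpW) (hout q v hqW)
  have hDcl : ∀ v ∈ D, ∀ u ∉ W, G.Adj v u → u ∈ D := fun v hv u hu hvu =>
    (hDmem u).2 (((hDmem v).1 hv).imp (fun h => h.tail ⟨hvu, hu⟩) fun h => h.tail ⟨hvu, hu⟩)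
  have hpD : p ∈ D := (hDmem p).2 (Or.inl .refl)
  have hqD : q ∈ D := (hDmem q).2 (Or.inr .refl)
  have hDadj : ∀ v ∈ D, ∀ u ∈ W, G.Adj v u → u = z 0 ∨ u = z 1 := by
    intro v hv u hu hvu
    refine ((hDmem v).1 hv).imp (fun h => ?_) fun h => ?_
    · exact (hG.eq_of_reflTransGen hz h hpW (hz.mem (by omega)) hu hp hvu).2.symm
    · exact (hG.eq_of_reflTransGen hz h hqW (hz.mem (by omega)) hu hq hvu).2.symm
  have hpq : ¬ G.Adj p q := fun h => hne
    (hG.eq_of_reflTransGen hz (.single ⟨h, hqW⟩) hpW (hz.mem (by omega)) (hz.mem (by omega))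
      hp hq).2
  obtain ⟨S, hpqS, hS⟩ := exists_isMaxIndepIn (G := G) (W := D) (T := {p, q})
    (by
      intro v
      simp only [Finset.mem_insert, Finset.mem_singleton]
      rintro (rfl | rfl) <;> assumption)
    (by
      intro x hx y hy hxy
      simp only [Finset.coe_insert, Finset.coe_singleton, Set.mem_insert_iff,
        Set.mem_singleton_iff] at hx hy
      rcases hx with rfl | rfl <;> rcases hy with rfl | rfl
      exacts [absurd rfl hxy, hpq, fun h => hpq h.symm, absurd rfl hxy])
  obtain ⟨hSD, hSi, hSmax⟩ := isMaxIndepIn_iff.1 hS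
  have hFW : ∀ f ∈ F, f ∉ W := fun f hf hfW => ((hF.mem_iff f).1 hfW).1 hf
  have hFi : ∀ x ∈ F, ∀ y ∈ F, ¬ G.Adj x y := fun x hx y hy h => hF.isIndepSet hx hy h.ne h
  have hSi' : ∀ x ∈ S, ∀ y ∈ S, ¬ G.Adj x y := fun x hx y hy h => hSi hx hy h.ne h
  refine not_wellCoveredOn_path (hz.adj_succ (i := 2) (by omega)) (hz.adj_succ (i := 3) (by omega))
    (fun hadj => ?_) (fun h02 => ?_) (hk.link (F := (F \ D) ∪ S) (Finset.subset_univ _) ?_ ?_)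
  · rw [hz.adj_iff 2 _ (by omega) (by omega)] at hadj
    omega
  · have := hz.inj 2 (by omega) _ (by omega) h02
    omega
  · intro x hx y hy _ hxy
    simp only [Finset.coe_union, Finset.coe_sdiff, Set.mem_union, Set.mem_sdiff,
      Finset.mem_coe] at hx hy
    rcases hx with hx | hx <;> rcases hy with hy | hy
    · exact hFi x hx.1 y hy.1 hxy
    · exact hx.2 (hDcl y (hSD hy) x (hFW x hx.1) hxy.symm)
    · exact hy.2 (hDcl x (hSD hx) y (hFW y hy.1) hxy)
    · exact hSi' x hx y hy hxy
  · intro v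
    constructor
    · intro hv
      obtain ⟨i, hi, hi', rfl⟩ : ∃ i, 2 ≤ i ∧ i < 5 ∧ z i = v := by
        simp only [Finset.mem_insert, Finset.mem_singleton] at hv
        rcases hv with rfl | rfl | rfl
        exacts [⟨2, by omega, by omega, rfl⟩, ⟨3, by omega, by omega, rfl⟩,
          ⟨4, by omega, by omega, rfl⟩]
      have hiW := hz.mem hi'
      refine ⟨Finset.mem_univ _, fun h => ?_, fun f hf hadj => ?_⟩
      · rcases Finset.mem_union.1 h with h | h
        · exact hFW _ (Finset.mem_sdiff.1 h).1 hiW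
        · exact hDW _ (hSD h) hiW
      · rcases Finset.mem_union.1 hf with h | h
        · exact ((hF.mem_iff _).1 hiW).2 f (Finset.mem_sdiff.1 h).1 hadj
        · rcases hDadj f (hSD h) _ hiW hadj with h | h
          · have := hz.inj i hi' 0 (by omega) h
            omega
          · have := hz.inj i hi' 1 (by omega) h
            omega
    · rintro ⟨-, hv, hvadj⟩
      rw [Finset.mem_union, not_or] at hv
      by_cases hvW : v ∈ W
      · obtain ⟨i, hi, rfl⟩ := (hz.mem_iff v).1 hvW
        have h0 : i ≠ 0 := by
          rintro rfl
          exact hvadj p (Finset.mem_union_right _ (hpqS (by simp))) hp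
        have h1 : i ≠ 1 := by
          rintro rfl
          exact hvadj q (Finset.mem_union_right _ (hpqS (by simp))) hq
        obtain rfl | rfl | rfl : i = 2 ∨ i = 3 ∨ i = 4 := by omega
        all_goals simp
      · exfalso
        by_cases hvD : v ∈ D
        · obtain ⟨s, hs, hsv⟩ := hSmax v hvD hv.2
          exact hvadj s (Finset.mem_union_right _ hs) hsv
        · have hvF : v ∉ F := fun h => hv.1 (Finset.mem_sdiff.2 ⟨h, hvD⟩)
          obtain ⟨f, hf, hfv⟩ := hF.exists_adj hvF hvW
          exact hvadj f (Finset.mem_union_left _ (Finset.mem_sdiff.2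
            ⟨hf, fun hfD => hvD (hDcl f hfD v hvW hfv)⟩)) hfv

end UniqueCycle

/-! ### Construction of the generating family -/

/-- An independent set of vertices of a pentagon is contained in a pair of nonadjacent vertices. -/
theorem exists_forall_eq_of_pentagon {B : ℕ → Prop}
    (h : ∀ i < 5, B i → B ((i + 1) % 5) → False) :
    ∃ r < 5, ∀ i < 5, B i → i = r ∨ i = (r + 3) % 5 := by
  by_contra hcon
  have h0 : B 1 ∨ B 2 ∨ B 4 := by
    by_contra! hB'
    exact hcon ⟨0, by omega, fun i hi hB => by interval_cases i <;> simp_all⟩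
  have h1 : B 0 ∨ B 2 ∨ B 3 := by
    by_contra! hB'
    exact hcon ⟨1, by omega, fun i hi hB => by interval_cases i <;> simp_all⟩
  have h2 : B 1 ∨ B 3 ∨ B 4 := by
    by_contra! hB'
    exact hcon ⟨2, by omega, fun i hi hB => by interval_cases i <;> simp_all⟩
  have h3 : B 0 ∨ B 2 ∨ B 4 := by
    by_contra! hB'
    exact hcon ⟨3, by omega, fun i hi hB => by interval_cases i <;> simp_all⟩
  have h4 : B 0 ∨ B 1 ∨ B 3 := by
    by_contra! hB'
    exact hcon ⟨4, by omega, fun i hi hB => by interval_cases i <;> simp_all⟩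
  have e0 : B 0 → B 1 → False := h 0 (by omega)
  have e1 : B 1 → B 2 → False := h 1 (by omega)
  have e2 : B 2 → B 3 → False := h 2 (by omega)
  have e3 : B 3 → B 4 → False := h 3 (by omega)
  have e4 : B 4 → B 0 → False := h 4 (by omega)
  by_cases b0 : B 0 <;> by_cases b1 : B 1 <;> by_cases b2 : B 2 <;> simp_all

/-- Removable vertices have neighbours outside the pentagon, so by `not_exists_adj_of_five` no two
of them are adjacent. -/
theorem HasExactlyOneCycle.hasGeneratingFamily_of_five [Fintype V] [DecidableEq V]
    (hG : G.HasExactlyOneCycle) {K : Type v} [Field K] {k : ℕ}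
    (hk : G.WellCoveredOn Finset.univ k) {F W : Finset V} (hF : G.IsLink F W) {z : ℕ → V}
    (hz : G.IsCycleOn W 5 z) : G.HasGeneratingFamily K W := by
  have hrot : ∀ i < 5, (fun i => ∃ p ∉ W, G.Adj p (z i)) i →
      (fun i => ∃ p ∉ W, G.Adj p (z i)) ((i + 1) % 5) → False := by
    intro i hi h1 h2
    refine hG.not_exists_adj_of_five hk hF (hz.rotate hi) ⟨by simpa [hi] using h1, ?_⟩
    by_cases h : 1 + i < 5
    · rw [if_pos h]
      rwa [Nat.mod_eq_of_lt (by omega), add_comm] at h2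
    · obtain rfl : i = 4 := by omega
      simpa using h2
  obtain ⟨r, hr, hr'⟩ := exists_forall_eq_of_pentagon hrot
  refine HasGeneratingFamily.of_isCycleOn_five (hz.rotate hr) fun v hv hv' => ?_
  obtain ⟨i, hi, rfl⟩ := (hz.mem_iff v).1 hv
  obtain rfl | rfl := hr' i hi hv'
  · simp [hr]
  · refine Or.inr ?_
    split_ifs with h
    · rw [Nat.mod_eq_of_lt (by omega), add_comm]
    · congr 1; omega

/-- Isolated vertices and pendant edges are removed one after the other, until what remains is
edgeless or a cycle of length three or five. All sets that occur are links. -/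
theorem HasExactlyOneCycle.hasGeneratingFamily [Fintype V] [DecidableEq V]
    (hG : G.HasExactlyOneCycle) {K₀ : Type w} [Field K₀] (h2 : (2 : K₀) ≠ 0)
    (hCM : IsCohenMacaulay (MvPolynomial V K₀ ⧸ G.edgeIdeal K₀)) (K : Type v) [Field K]
    {F W : Finset V} (hF : G.IsLink F W) : G.HasGeneratingFamily K W := by
  obtain ⟨k, hk⟩ := exists_wellCoveredOn_univ hCM
  induction hn : W.card using Nat.strong_induction_on generalizing F W with
  | _ n ih =>
  by_cases hedge : ∀ x ∈ W, ∀ y ∈ W, ¬ G.Adj x y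
  · exact hasGeneratingFamily_of_forall_not_adj hedge
  push Not at hedge
  obtain ⟨x, hx, -⟩ := hedge
  by_cases hiso : ∃ c ∈ W, ∀ v ∈ W, ¬ G.Adj c v
  · obtain ⟨c, hc, hiso⟩ := hiso
    obtain ⟨hcF, hcadj⟩ := (hF.mem_iff c).1 hc
    have hlink : G.IsLink (insert c F) (W.erase c) :=
      ⟨isIndepSet_insert hF.isIndepSet fun f hf h => hcadj f hf h.symm, fun v => by
        have := hF.mem_iff v
        have := hiso v
        simp only [Finset.mem_erase, Finset.mem_insert, forall_eq_or_imp]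
        tauto⟩
    exact HasGeneratingFamily.of_isolated hc hiso
      (ih _ (hn ▸ Finset.card_erase_lt_of_mem hc) hlink rfl)
  by_cases hpend : ∃ a b, G.IsPendantIn W a b
  · obtain ⟨a, b, h⟩ := hpend
    obtain ⟨hbF, hbadj⟩ := (hF.mem_iff b).1 h.right_mem
    have hlink : G.IsLink (insert b F) ((W.erase a).erase b) :=
      ⟨isIndepSet_insert hF.isIndepSet fun f hf h => hbadj f hf h.symm, fun v => by
        have := hF.mem_iff v
        rw [h.mem_erase_iff]
        simp only [Finset.mem_insert, forall_eq_or_imp]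
        tauto⟩
    refine HasGeneratingFamily.of_isPendantIn h (ih _ ?_ hlink rfl)
    exact ((Finset.card_le_card (Finset.erase_subset _ _)).trans_lt
      (Finset.card_erase_lt_of_mem h.left_mem)).trans_eq hn
  push Not at hiso
  have hdeg : ∀ v ∈ W, ∀ a, ∃ u ∈ W, u ≠ a ∧ G.Adj v u := by
    intro v hv a
    obtain ⟨u, hu, hvu⟩ := hiso v hv
    by_contra! hcon
    have : ∀ t ∈ W, G.Adj v t → t = a := fun t ht hvt => by
      by_contra hta
      exact hcon t ht hta hvt
    exact hpend ⟨u, v, hu, hv, hvu.symm, fun t ht hvt => (this t ht hvt).trans (this u hu hvu).symm⟩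
  obtain ⟨l, z, hl, hz⟩ := hG.exists_isCycleOn ⟨x, hx⟩ hdeg
  have hkW := hk.link (Finset.subset_univ _) hF.isIndepSet (U' := W) fun v => by
    rw [hF.mem_iff]; simp
  have h4 : l ≠ 4 := by rintro rfl; exact hF.not_isCycleOn_four hCM hz
  have h7 : l ≠ 7 := by rintro rfl; exact hF.not_isCycleOn_seven h2 hCM hz
  have h6 : l < 6 := by
    by_contra! h6
    exact hz.not_wellCoveredOn h6 h7 hkW
  obtain rfl | rfl : l = 3 ∨ l = 5 := by omega
  · exact HasGeneratingFamily.of_isCycleOn_three hz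
  · exact hG.hasGeneratingFamily_of_five hk hF hz

/-! ### Height and arithmetical rank -/

/-- The variables not in a prime that contains the edge ideal form an independent set, so at least
`m` variables lie in it. -/
theorem WellCoveredOn.card_le_height [Fintype V] {k : ℕ} (hk : G.WellCoveredOn Finset.univ k)
    (K : Type v) [Field K] {m : ℕ} (hm : m + k = Fintype.card V) :
    (m : ℕ∞) ≤ (G.edgeIdeal K).height := by
  classical
  rw [Ideal.height_eq_inf_minimalPrimes]
  refine le_iInf₂ fun P hP => ?_
  have hPprime : P.IsPrime := hP.1.1
  set E : Finset V := Finset.univ.filter fun v => (X v : MvPolynomial V K) ∈ P with hE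
  have hEmem : ∀ v, v ∈ E ↔ (X v : MvPolynomial V K) ∈ P := fun v => by simp [hE]
  have hind : G.IsIndepSet ((Eᶜ : Finset V) : Set V) := by
    intro x hx y hy _ hxy
    simp only [Finset.coe_compl, Set.mem_compl_iff, Finset.mem_coe, hEmem] at hx hy
    exact (hPprime.mem_or_mem (hP.1.2 (X_mul_X_mem_edgeIdeal hxy))).elim hx hy
  have h1 := hk.card_le (Finset.subset_univ _) hind
  have h2 := Finset.card_add_card_compl E
  have h3 := card_le_height_map_ker_specialize (RingHom.id (MvPolynomial V K))
    Function.surjective_id (0 : V → K) (D := ∅) (E := E) (by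
      intro f hf; rw [RingHom.mem_ker, RingHom.id_apply] at hf; rw [hf]; exact Ideal.zero_mem _)
    (by simp)
  rw [Ideal.map_id, Finset.empty_union] at h3
  calc (m : ℕ∞) ≤ E.card := by exact_mod_cast (by omega : m ≤ E.card)
    _ ≤ _ := h3
    _ ≤ P.height := Ideal.height_mono (ker_specialize_le _ fun v hv => by simpa [hEmem] using hv)

end SimpleGraph

theorem Ideal.height_radical_eq {R : Type*} [CommRing R] (I : Ideal R) :
    I.radical.height = I.height := by
  rw [Ideal.height_eq_inf_minimalPrimes, Ideal.height_eq_inf_minimalPrimes,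
    Ideal.radical_minimalPrimes]

/-- Krull's height theorem, applied to ideals with the same radical. -/
theorem Ideal.height_le_arithmeticalRank {R : Type*} [CommRing R] [IsNoetherianRing R]
    {I : Ideal R} (hI : I ≠ ⊤) : I.height ≤ arithmeticalRank I := by
  refine le_iInf₂ fun s hs => ?_
  rw [← I.height_radical_eq, ← hs, Ideal.height_radical_eq]
  have hne : Ideal.span (s : Set R) ≠ ⊤ := fun h => hI (by
    rwa [h, Ideal.radical_top, eq_comm, Ideal.radical_eq_top] at hs)
  obtain ⟨P, hP⟩ := Ideal.nonempty_minimalPrimes hne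
  rw [Ideal.height_eq_inf_minimalPrimes]
  exact (iInf₂_le P hP).trans (Ideal.height_le_card_of_mem_minimalPrimes_span_finset hP)

namespace SimpleGraph

variable {V : Type u} {G : SimpleGraph V}

/-- On the whole vertex set with no vertex deleted, the generating family generates the edge ideal
up to radical. -/
theorem IsGeneratingFamily.arithmeticalRank_le [Fintype V] [DecidableEq V] {K : Type v} [Field K]
    {k m : ℕ} {f : Finset V → ℕ → MvPolynomial V K} (hk : G.WellCoveredOn Finset.univ k)
    (hf : G.IsGeneratingFamily K Finset.univ k m f) : arithmeticalRank (G.edgeIdeal K) ≤ m := by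
  classical
  have hrem : G.Removable Finset.univ k ∅ := ⟨by simp, by simp, by simpa using hk⟩
  have hres : G.restrictedIdeal K Finset.univ ∅ = G.edgeIdeal K :=
    le_antisymm (restrictedIdeal_le_iff.2 ⟨fun x _ y _ h => X_mul_X_mem_edgeIdeal h, by simp⟩)
      (edgeIdeal_le_iff.2 fun x y h =>
        X_mul_X_mem_restrictedIdeal (Finset.mem_univ x) (Finset.mem_univ y) h)
  refine (iInf₂_le ((Finset.range m).image (f ∅)) ?_).trans ?_
  · have := hf.radical_eq ∅ hrem
    rwa [hres, ← Finset.coe_range, ← Finset.coe_image] at this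
  · exact_mod_cast Finset.card_image_le.trans_eq (Finset.card_range m)

end SimpleGraph

theorem theorem5p5 {V : Type u} [Finite V] (G : SimpleGraph V)
    (hCM : SimpleGraph.IsCohenMacaulayGraph.{u, w} G) (hG : G.HasExactlyOneCycle)
    (K : Type v) [Field K] :
    IsSetTheoreticCompleteIntersection (G.edgeIdeal K) := by
  classical
  have := Fintype.ofFinite V
  have hQ := hCM (ULift.{w} ℚ)
  have h2 : (2 : ULift.{w} ℚ) ≠ 0 := fun h => by
    have := congrArg ULift.down h
    norm_num at this
  obtain ⟨k, hk⟩ := SimpleGraph.exists_wellCoveredOn_univ hQ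
  have huniv : G.IsLink ∅ Finset.univ := ⟨by simp, by simp⟩
  obtain ⟨m, f, hm, hf⟩ := hG.hasGeneratingFamily h2 hQ K huniv k hk
  refine le_antisymm ((hf.arithmeticalRank_le hk).trans (hk.card_le_height K hm)) ?_
  refine Ideal.height_le_arithmeticalRank fun htop => ?_
  -- all edges vanish at the origin
  have hle : G.edgeIdeal K ≤ RingHom.ker (constantCoeff (σ := V) (R := K)) :=
    SimpleGraph.edgeIdeal_le_iff.2 fun x y _ => by simp [RingHom.mem_ker]
  rw [htop, top_le_iff] at hle
  exact RingHom.ker_ne_top _ hle
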